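/- Theorem C. Let $(M,\omega)$ be a four-dimensional symplectic manifold, $\rho\colon M\to M$ an antisymplectic involution (a smooth map with $\rho^2=\mathrm{id}$, $\rho^*\omega=-\omega$), and $H\colon M\to\mathbb R$ a smooth function with $H\circ\rho=H$. Let $X_H$ be its Hamiltonian vector field, $dH=\omega(\cdot,X_H)$, and $\phi_H^t$ the (possibly only partially defined) flow of $X_H$. Let $v\colon\mathbb R/\tau\mathbb Z\to M$, $\tau>0$, be a nonconstant symmetric periodic orbit: $\dot v=X_H(v)$ and $\rho(v(-t))=v(t)$ for all $t$. Its symmetric points are $v(0)$ and $v(\tau/2)$. At each symmetric point $x$ put $Q_x=\ker dH(x)/\langle X_H(x)\rangle$, with the bilinear form induced by $\omega_x$. Then $\phi_H^\tau(x)=x$, $\phi_H^\tau$ is differentiable at $x$ and $d\phi_H^\tau(x)$ preserves $\ker dH(x)$ and $\langle X_H(x)\rangle$, so that it induces an endomorphism $M_x$ of $Q_x$, the reduced monodromy; and $d\rho(x)$ induces an involution $R_x$ of $Q_x$. There are bases $(e_1,e_2)$ of $Q_x$ with $\omega(e_1,e_2)=1$, $R_xe_1=e_1$, $R_xe_2=-e_2$;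 and if $\begin{pmatrix}a&b\\c&d\end{pmatrix}$ is the matrix of $M_x$ in such a basis, then $\mathrm{sign}(b)\in\{-1,0,1\}$ does not depend on the basis. It is called the B-sign at $x$. Thus $v$ has two B-signs, $s_0$ at $v(0)$ and $s_1$ at $v(\tau/2)$. The orbit $v$ is called negative hyperbolic if $\mathrm{tr}\,M_{v(0)}<-2$. Then: (i) if $\mathrm{tr}\,M_{v(0)}\neq\pm2$, both B-signs are nonzero; (ii) if $\mathrm{tr}\,M_{v(0)}\neq-2$, then $v$ is negative hyperbolic if and only if $s_0\neq s_1$. -/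

import Mathlib

open scoped Manifold ContDiff

noncomputable section

namespace SymOrbit

section Symplectic

variable {E : Type*} [NormedAddCommGroup E] [NormedSpace ℝ E]
  {M : Type*} [TopologicalSpace M] [ChartedSpace E M]

/-- The coefficient function `z ↦ (φ^*Ω)_z(u, w)` of a field of bilinear forms in a chart, where
`φ` is the inverse of the chart `e` and `u`, `w` are constant vectors of the model space. -/
def coeffInChart (Ω : ∀ x : M, LinearMap.BilinForm ℝ (TangentSpace 𝓘(ℝ, E) x))
    (e : OpenPartialHomeomorph M E) (u w : E) (z : E) : ℝ :=
  Ω (e.symm z) (mfderiv 𝓘(ℝ, E) 𝓘(ℝ, E) e.symm z u) (mfderiv 𝓘(ℝ, E) 𝓘(ℝ, E) e.symm z w)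

variable (E M) in
/-- A symplectic form on a manifold `M` without boundary modelled on `E`: a smooth, closed,
alternating, nondegenerate 2-form. Smoothness and closedness are expressed in the charts of `M`. -/
structure SymplecticForm where
  /-- the bilinear form on each tangent space -/
  toFun : ∀ x : M, LinearMap.BilinForm ℝ (TangentSpace 𝓘(ℝ, E) x)
  alternating : ∀ (x : M) (u : TangentSpace 𝓘(ℝ, E) x), toFun x u u = 0
  nondegenerate : ∀ (x : M) (u : TangentSpace 𝓘(ℝ, E) x), (∀ w, toFun x u w = 0) → u = 0
  smooth : ∀ e ∈ atlas E M, ∀ u w : E, ContDiffOn ℝ ∞ (coeffInChart toFun e u w) e.target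
  closed : ∀ e ∈ atlas E M, ∀ z ∈ e.target, ∀ u v w : E,
    fderiv ℝ (coeffInChart toFun e v w) z u + fderiv ℝ (coeffInChart toFun e w u) z v
      + fderiv ℝ (coeffInChart toFun e u v) z w = 0

/-- An antisymplectic involution (real structure): `ρ` is smooth, `ρ² = id` and `ρ^*Ω = -Ω`. -/
structure IsAntisymplecticInvolution (Ω : SymplecticForm E M) (ρ : M → M) : Prop where
  smooth : ContMDiff 𝓘(ℝ, E) 𝓘(ℝ, E) ∞ ρ
  involutive : Function.Involutive ρ
  antisymplectic : ∀ (x : M) (u w : TangentSpace 𝓘(ℝ, E) x),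
    Ω.toFun (ρ x) (mfderiv 𝓘(ℝ, E) 𝓘(ℝ, E) ρ x u) (mfderiv 𝓘(ℝ, E) 𝓘(ℝ, E) ρ x w)
      = - Ω.toFun x u w

/-- The differential of a function `H : M → ℝ` at `x`, as a linear functional. -/
def differential (H : M → ℝ) (x : M) : TangentSpace 𝓘(ℝ, E) x →ₗ[ℝ] ℝ :=
  (mfderiv 𝓘(ℝ, E) 𝓘(ℝ, ℝ) H x : TangentSpace 𝓘(ℝ, E) x →L[ℝ] ℝ).toLinearMap

theorem exists_hamiltonianVector [FiniteDimensional ℝ E] (Ω : SymplecticForm E M) (H : M → ℝ)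
    (x : M) : ∃ X : TangentSpace 𝓘(ℝ, E) x, ∀ u, differential H x u = Ω.toFun x u X := by
  have : FiniteDimensional ℝ (TangentSpace 𝓘(ℝ, E) x) := inferInstanceAs (FiniteDimensional ℝ E)
  have hinj : Function.Injective (Ω.toFun x) := by
    rw [← LinearMap.ker_eq_bot, LinearMap.ker_eq_bot']
    intro u hu
    exact Ω.nondegenerate x u fun w => by rw [hu]; rfl
  have hsurj : Function.Surjective (Ω.toFun x) :=
    (LinearMap.injective_iff_surjective_of_finrank_eq_finrank
      (Subspace.dual_finrank_eq).symm).1 hinj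
  obtain ⟨Y, hY⟩ := hsurj (differential H x)
  refine ⟨-Y, fun u => ?_⟩
  have halt : LinearMap.IsAlt (Ω.toFun x) := Ω.alternating x
  rw [← hY, map_neg]
  exact (halt.neg u Y).symm

/-- The Hamiltonian vector field `X_H`, determined by `dH = Ω(·, X_H)`. -/
def hamiltonianVectorField [FiniteDimensional ℝ E] (Ω : SymplecticForm E M) (H : M → ℝ) (x : M) :
    TangentSpace 𝓘(ℝ, E) x :=
  (exists_hamiltonianVector Ω H x).choose

theorem hamiltonianVectorField_spec [FiniteDimensional ℝ E] (Ω : SymplecticForm E M) (H : M → ℝ)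
    (x : M) (u : TangentSpace 𝓘(ℝ, E) x) :
    differential H x u = Ω.toFun x u (hamiltonianVectorField Ω H x) :=
  (exists_hamiltonianVector Ω H x).choose_spec u

end Symplectic

section Flow

variable {E : Type*} [NormedAddCommGroup E] [NormedSpace ℝ E]
  {M : Type*} [TopologicalSpace M] [ChartedSpace E M]

/-- `γ` is a solution of `γ' = X(γ)`, `γ 0 = x`, on an open interval containing `0` and `t`. -/
def IsSolutionUpTo (X : ∀ x : M, TangentSpace 𝓘(ℝ, E) x) (x : M) (t : ℝ) (γ : ℝ → M) : Prop :=
  γ 0 = x ∧ ∃ a b : ℝ, 0 ∈ Set.Ioo a b ∧ t ∈ Set.Ioo a b ∧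
    IsMIntegralCurveOn (I := 𝓘(ℝ, E)) γ X (Set.Ioo a b)

open Classical in
/-- The (possibly only partially defined) flow of a vector field: `flow X t x` is the value at time
`t` of the solution starting at `x`. The vector field need not be complete; the value is the
irrelevant point `x` when that solution does not exist up to time `t`. -/
def flow (X : ∀ x : M, TangentSpace 𝓘(ℝ, E) x) (t : ℝ) (x : M) : M :=
  if h : ∃ γ : ℝ → M, IsSolutionUpTo X x t γ then h.choose t else x

/-- The differential of a map `f : M → M` at a fixed point `x` of `f`, as an endomorphism of `T_x M`.
It is only used at points with `f x = x`, where `T_{f x} M` is `T_x M`. -/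
def differentialAtFixedPoint (f : M → M) (x : M) : Module.End ℝ (TangentSpace 𝓘(ℝ, E) x) :=
  (mfderiv 𝓘(ℝ, E) 𝓘(ℝ, E) f x :
    TangentSpace 𝓘(ℝ, E) x →L[ℝ] TangentSpace 𝓘(ℝ, E) x).toLinearMap

end Flow

section Subquotient

variable {V : Type*} [AddCommGroup V] [Module ℝ V]

/-- `A` maps `K` to itself and `L` to itself. -/
def Preserves (K L : Submodule ℝ V) (A : Module.End ℝ V) : Prop :=
  (∀ u ∈ K, A u ∈ K) ∧ (∀ u ∈ L, A u ∈ L)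

open Classical in
/-- The endomorphism of `K / (L ∩ K)` induced by an endomorphism `A` which preserves `K` and `L`
(and zero when `A` does not preserve them). -/
def inducedEnd (K L : Submodule ℝ V) (A : Module.End ℝ V) :
    Module.End ℝ (K ⧸ L.submoduleOf K) :=
  if h : Preserves K L A then
    (L.submoduleOf K).mapQ (L.submoduleOf K) (A.restrict h.1) (fun u hu => h.2 u hu)
  else 0

end Subquotient

section Reduced

variable {E : Type*} [NormedAddCommGroup E] [NormedSpace ℝ E] [FiniteDimensional ℝ E]
  {M : Type*} [TopologicalSpace M] [ChartedSpace E M]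

/-- The tangent space `T_x Σ = ker dH(x)` of the energy hypersurface `Σ = H⁻¹(H x)`
at a point `x` where `dH(x) ≠ 0`. -/
def energyTangent (H : M → ℝ) (x : M) : Submodule ℝ (TangentSpace 𝓘(ℝ, E) x) :=
  LinearMap.ker (differential H x)

/-- The line `⟨X_H(x)⟩`. -/
def hamiltonianLine (Ω : SymplecticForm E M) (H : M → ℝ) (x : M) :
    Submodule ℝ (TangentSpace 𝓘(ℝ, E) x) :=
  Submodule.span ℝ {hamiltonianVectorField Ω H x}

/-- The reduced space `T_x Σ / ⟨X_H(x)⟩`. -/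
abbrev ReducedSpace (Ω : SymplecticForm E M) (H : M → ℝ) (x : M) : Type _ :=
  energyTangent (E := E) H x ⧸ (hamiltonianLine Ω H x).submoduleOf (energyTangent H x)

theorem form_eq_zero_of_mem (Ω : SymplecticForm E M) (H : M → ℝ) (x : M)
    {u w : TangentSpace 𝓘(ℝ, E) x} (hu : u ∈ energyTangent H x)
    (hw : w ∈ hamiltonianLine Ω H x) : Ω.toFun x u w = 0 := by
  obtain ⟨c, rfl⟩ := Submodule.mem_span_singleton.1 hw
  rw [map_smul, ← hamiltonianVectorField_spec Ω H x u]
  have : differential H x u = 0 := hu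
  rw [this, smul_zero]

/-- The bilinear form on `T_x Σ / ⟨X_H(x)⟩` induced by `Ω_x`: `([u], [w]) ↦ Ω_x(u, w)`. -/
def reducedForm (Ω : SymplecticForm E M) (H : M → ℝ) (x : M) :
    LinearMap.BilinForm ℝ (ReducedSpace Ω H x) :=
  LinearMap.liftQ₂ ((hamiltonianLine Ω H x).submoduleOf (energyTangent H x))
    ((hamiltonianLine Ω H x).submoduleOf (energyTangent H x))
    ((Ω.toFun x).domRestrict₁₂ (energyTangent H x) (energyTangent H x))
    (fun u hu => LinearMap.ext fun w => by
      have halt : LinearMap.IsAlt (Ω.toFun x) := Ω.alternating x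
      have h := form_eq_zero_of_mem Ω H x w.2 hu
      have h' := halt.neg (w : TangentSpace 𝓘(ℝ, E) x) (u : TangentSpace 𝓘(ℝ, E) x)
      change Ω.toFun x u w = 0
      rw [← h']
      exact neg_eq_zero.2 h)
    (fun w hw => LinearMap.ext fun u => form_eq_zero_of_mem Ω H x u.2 hw)

theorem reducedForm_mk (Ω : SymplecticForm E M) (H : M → ℝ) (x : M)
    (u w : energyTangent (E := E) H x) :
    reducedForm Ω H x (Submodule.Quotient.mk u) (Submodule.Quotient.mk w)
      = Ω.toFun x (u : TangentSpace 𝓘(ℝ, E) x) (w : TangentSpace 𝓘(ℝ, E) x) := rfl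

/-- The unreduced monodromy `dφ_H^τ(x)` at a point `x` of a `τ`-periodic orbit. -/
def monodromy (Ω : SymplecticForm E M) (H : M → ℝ) (τ : ℝ) (x : M) :
    Module.End ℝ (TangentSpace 𝓘(ℝ, E) x) :=
  differentialAtFixedPoint (flow (hamiltonianVectorField Ω H) τ) x

/-- The reduced monodromy at `x` is meaningful: `x` is fixed by the time-`τ` flow, the flow map is
differentiable at `x`, and its differential preserves `T_x Σ` and `⟨X_H(x)⟩`. -/
def HasReducedMonodromy (Ω : SymplecticForm E M) (H : M → ℝ) (τ : ℝ) (x : M) : Prop :=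
  flow (hamiltonianVectorField Ω H) τ x = x ∧
  MDifferentiableAt 𝓘(ℝ, E) 𝓘(ℝ, E) (flow (hamiltonianVectorField Ω H) τ) x ∧
  Preserves (energyTangent H x) (hamiltonianLine Ω H x) (monodromy Ω H τ x)

/-- The reduced monodromy, the endomorphism of `T_x Σ / ⟨X_H(x)⟩` induced by `dφ_H^τ(x)`. -/
def reducedMonodromy (Ω : SymplecticForm E M) (H : M → ℝ) (τ : ℝ) (x : M) :
    Module.End ℝ (ReducedSpace Ω H x) :=
  inducedEnd (energyTangent H x) (hamiltonianLine Ω H x) (monodromy Ω H τ x)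

/-- The involution of `T_x Σ / ⟨X_H(x)⟩` induced by `dρ(x)`, for a point `x` fixed by `ρ`. -/
def reducedInvolution (Ω : SymplecticForm E M) (H : M → ℝ) (ρ : M → M) (x : M) :
    Module.End ℝ (ReducedSpace Ω H x) :=
  inducedEnd (energyTangent H x) (hamiltonianLine Ω H x) (differentialAtFixedPoint ρ x)

/-- A symplectic basis of the (two-dimensional) reduced space consisting of eigenvectors of the
induced involution `R`, i.e. one in which `R` has the matrix `diag(1, -1)`. -/
def IsSymplecticEigenbasis (Ω : SymplecticForm E M) (H : M → ℝ) (ρ : M → M) (x : M)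
    (e : Module.Basis (Fin 2) ℝ (ReducedSpace Ω H x)) : Prop :=
  reducedForm Ω H x (e 0) (e 1) = 1 ∧
  reducedInvolution Ω H ρ x (e 0) = e 0 ∧ reducedInvolution Ω H ρ x (e 1) = - e 1

/-- `s` is the B-sign at `x`: the sign of the entry `b` of the matrix `(a, b; c, d)` of the
reduced monodromy in some symplectic basis of eigenvectors of the induced involution. -/
def IsBSign (Ω : SymplecticForm E M) (H : M → ℝ) (ρ : M → M) (τ : ℝ) (x : M) (s : SignType) :
    Prop :=
  ∃ e : Module.Basis (Fin 2) ℝ (ReducedSpace Ω H x), IsSymplecticEigenbasis Ω H ρ x e ∧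
    s = SignType.sign (LinearMap.toMatrix e e (reducedMonodromy Ω H τ x) 0 1)

/-- The trace of the reduced monodromy at `x`. -/
def reducedTrace (Ω : SymplecticForm E M) (H : M → ℝ) (τ : ℝ) (x : M) : ℝ :=
  LinearMap.trace ℝ (ReducedSpace Ω H x) (reducedMonodromy Ω H τ x)

/-- A nonconstant periodic orbit `v : ℝ / τℤ → M` of `X_H`, given by its lift to `ℝ`. -/
structure IsPeriodicOrbit (Ω : SymplecticForm E M) (H : M → ℝ) (τ : ℝ) (v : ℝ → M) : Prop where
  period_pos : 0 < τ
  integralCurve : IsMIntegralCurve (I := 𝓘(ℝ, E)) v (hamiltonianVectorField Ω H)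
  periodic : Function.Periodic v τ
  nonconstant : ∃ s t : ℝ, v s ≠ v t

/-- A periodic orbit with `ρ (v (-t)) = v t` for all `t`. Its symmetric points are `v 0` and
`v (τ / 2)`. -/
structure IsSymmetricPeriodicOrbit (Ω : SymplecticForm E M) (H : M → ℝ) (ρ : M → M) (τ : ℝ)
    (v : ℝ → M) : Prop extends IsPeriodicOrbit Ω H τ v where
  symmetric : ∀ t : ℝ, ρ (v (-t)) = v t

/-- The orbit `v` is negative hyperbolic: the trace of its reduced monodromy `M_v` (at `v 0`)
is less than `-2`. -/
def IsNegativeHyperbolic (Ω : SymplecticForm E M) (H : M → ℝ) (τ : ℝ) (v : ℝ → M) : Prop :=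
  reducedTrace Ω H τ (v 0) < -2

end Reduced

end SymOrbit

end

/-! The half-period flow splits the monodromy. Write Q₀, Q₁ for the reduced spaces at `v 0` and `v
(τ / 2)`, and let f : Q₀ → Q₁ and g : Q₁ → Q₀ be induced by the differential of φ^{τ/2} at these
points. Then the reduced monodromies are gf at `v 0` and fg at `v (τ / 2)`. Since ρ reverses the
flow, φ^{τ/2} ∘ ρ ∘ φ^{τ/2} = ρ near `v 0`, hence g R₁ f = R₀.

In symplectic eigenbases f = (a, b; c, d) with ad - bc = 1, and the reversal relation forces g = (d,
b; c, a). So gf has upper right entry 2bd, fg has 2ab, and the trace is 2(ad + bc) = 4ad - 2. Trace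
-2 means ad = 0 and trace 2 means bc = 0, which gives (i). Trace below -2 means ad < 0; then bc = ad
- 1 < 0, so b ≠ 0 and the signs of bd and ab are opposite. If ad > 0, then a and d have the same
sign and the B-signs agree, even when b = 0. This is `monodromy_entries` followed by
`sign_entries_dichotomy`.

The analytic task is to show that the partial flow is differentiable and symplectic along the orbit.
In a chart this is the first variation equation, estimated by Grönwall
(`hasFDerivAt_of_linearized`), together with the vanishing Lie derivative of the form
(`lieDerivative_eq_zero`). Compactness of the orbit and composition of short-time flows then reach
every nonnegative time (`IsPeriodicOrbit.flowIsSymplecticAt`). -/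

noncomputable section

namespace SymOrbit

open Set Metric Filter Topology NNReal

/-! ### Differentiable dependence of solutions on the initial point -/

section ODE

variable {E : Type*} [NormedAddCommGroup E] [NormedSpace ℝ E]

/-- Solutions of an autonomous `C¹` equation exist for a uniform time, for all initial points near
`x₀`, and stay in a prescribed neighbourhood of `x₀`. -/
theorem exists_solution_mem_nhds [CompleteSpace E] {f : E → E} {x₀ : E} (hf : ContDiffAt ℝ 1 f x₀)
    {W : Set E} (hW : W ∈ 𝓝 x₀) :
    ∃ N ∈ 𝓝 x₀, ∃ ε > (0 : ℝ), ∀ x ∈ N, ∃ α : ℝ → E, α 0 = x ∧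
      ∀ t ∈ Ioo (-ε) ε, HasDerivAt α (f (α t)) t ∧ α t ∈ W := by
  obtain ⟨ε, hε, a, r, L, K, hr, hpl⟩ := IsPicardLindelof.of_contDiffAt_one hf
  obtain ⟨α, hα, hc⟩ := (hpl 0).exists_forall_mem_closedBall_eq_hasDerivWithinAt_continuousOn
  have hmem : closedBall x₀ (r : ℝ) ×ˢ Icc (0 - ε) (0 + ε) ∈ 𝓝 (x₀, (0 : ℝ)) :=
    prod_mem_nhds (closedBall_mem_nhds _ hr) (Icc_mem_nhds (by linarith) (by linarith))
  have hca : ContinuousAt α (x₀, 0) := hc.continuousAt hmem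
  have hα0 : α (x₀, 0) = x₀ := (hα x₀ (mem_closedBall_self r.2)).1
  have hpre : α ⁻¹' W ∈ 𝓝 (x₀, (0 : ℝ)) := hca (by rwa [hα0])
  obtain ⟨N, hN, S, hS, hNS⟩ := mem_nhds_prod_iff.1 (inter_mem hmem hpre)
  obtain ⟨δ, hδ, hδS⟩ := Metric.mem_nhds_iff.1 hS
  refine ⟨N, hN, min δ ε, lt_min hδ hε, fun x hx => ⟨fun t => α (x, t), ?_, fun t ht => ?_⟩⟩
  · exact (hα x (hNS (mk_mem_prod hx (mem_of_mem_nhds hS))).1.1).1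
  · have h1 : t < ε := ht.2.trans_le (min_le_right _ _)
    have h2 : -ε < t := by have := min_le_right δ ε; linarith [ht.1]
    have htS : t ∈ S := hδS (by
      rw [Real.ball_eq_Ioo]
      constructor <;> have := min_le_left δ ε <;> linarith [ht.1, ht.2])
    have hxt := hNS (mk_mem_prod hx htS)
    refine ⟨?_, hxt.2⟩
    exact ((hα x hxt.1.1).2 t hxt.1.2).hasDerivAt (Icc_mem_nhds (by linarith) (by linarith))

/-- The time-`T` map of a `C²` equation is differentiable, with derivative the solution of the
linearized equation. -/
theorem hasFDerivAt_of_linearized {f : E → E} {W : Set E} (hW : Convex ℝ W) {f' : E → E →L[ℝ] E}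
    (hf : ∀ z ∈ W, HasFDerivWithinAt f (f' z) W z) {K K' : ℝ≥0}
    (hK : ∀ z ∈ W, ‖f' z‖ ≤ K) (hK' : LipschitzOnWith K' f' W)
    {α : E → ℝ → E} {x : E} {T : ℝ} (hT : 0 ≤ T) {A : ℝ → E →L[ℝ] E} (hA0 : A 0 = 1)
    (hA : ∀ t ∈ Icc 0 T, HasDerivAt A (f' (α x t) ∘L A t) t)
    (hα : ∀ᶠ y in 𝓝 x, α y 0 = y ∧ ∀ t ∈ Icc 0 T, HasDerivAt (α y) (f (α y t)) t ∧ α y t ∈ W) :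
    HasFDerivAt (fun y => α y T) (A T) x := by
  have hlip : LipschitzOnWith K f W :=
    hW.lipschitzOnWith_of_nnnorm_hasFDerivWithin_le hf fun z hz => hK z hz
  obtain ⟨hx0, hx⟩ := hα.self_of_nhds
  have hAc : ContinuousOn A (Icc 0 T) := fun t ht => (hA t ht).continuousAt.continuousWithinAt
  -- The Taylor remainder is at most K' times the squared distance of two solutions, and that
  -- distance grows by at most the factor exp(KT).
  set C : ℝ := K' * Real.exp (K * T) ^ 2 with hC
  have hC0 : 0 ≤ C := by positivity
  have key : ∀ᶠ y in 𝓝 x, ‖α y T - α x T - A T (y - x)‖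
      ≤ gronwallBound 0 K (C * ‖y - x‖ ^ 2) T := by
    filter_upwards [hα] with y hy
    obtain ⟨hy0, hy⟩ := hy
    have hdist : ∀ t ∈ Icc 0 T, ‖α y t - α x t‖ ≤ ‖y - x‖ * Real.exp (K * T) := by
      intro t ht
      have := dist_le_of_trajectories_ODE_of_mem (v := fun _ => f) (s := fun _ => W) (K := K)
        (f := α y) (g := α x) (a := 0) (b := T) (δ := ‖y - x‖)
        (fun _ _ => hlip) (fun t ht => (hy t ht).1.continuousAt.continuousWithinAt)
        (fun t ht => (hy t (Ico_subset_Icc_self ht)).1.hasDerivWithinAt)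
        (fun t ht => (hy t (Ico_subset_Icc_self ht)).2)
        (fun t ht => (hx t ht).1.continuousAt.continuousWithinAt)
        (fun t ht => (hx t (Ico_subset_Icc_self ht)).1.hasDerivWithinAt)
        (fun t ht => (hx t (Ico_subset_Icc_self ht)).2)
        (by rw [hy0, hx0, dist_eq_norm]) t ht
      rw [dist_eq_norm, sub_zero] at this
      refine this.trans ?_
      gcongr
      exact ht.2
    -- The error of the linear approximation starts at 0 and solves the linearized equation up to
    -- the quadratic Taylor remainder of f, so Grönwall makes it O(‖y - x‖²).
    have hz : ∀ t ∈ Icc 0 T, HasDerivAt (fun t => α y t - α x t - A t (y - x))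
        (f (α y t) - f (α x t) - f' (α x t) (A t (y - x))) t := fun t ht =>
      (((hy t ht).1.sub (hx t ht).1).sub ((hA t ht).clm_apply (hasDerivAt_const t (y - x)))).congr_deriv
        (by simp)
    have := norm_le_gronwallBound_of_norm_deriv_right_le (K := (K : ℝ)) (δ := 0)
      (ε := C * ‖y - x‖ ^ 2) (fun t ht => (hz t ht).continuousAt.continuousWithinAt)
      (fun t ht => (hz t (Ico_subset_Icc_self ht)).hasDerivWithinAt)
      (by simp [hy0, hx0, hA0]) ?_ T ⟨hT, le_rfl⟩
    · simpa using this
    intro t ht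
    have ht' := Ico_subset_Icc_self ht
    have hseg : segment ℝ (α x t) (α y t) ⊆ W := hW.segment_subset (hx t ht').2 (hy t ht').2
    have hrem : ‖f (α y t) - f (α x t) - f' (α x t) (α y t - α x t)‖
        ≤ K' * ‖α y t - α x t‖ * ‖α y t - α x t‖ := by
      refine (convex_segment (α x t) (α y t)).norm_image_sub_le_of_norm_hasFDerivWithin_le'
        (fun z hz => (hf z (hseg hz)).mono hseg) (fun z hz => ?_) (left_mem_segment ℝ _ _)
        (right_mem_segment ℝ _ _)
      refine (hK'.norm_sub_le (hseg hz) (hx t ht').2).trans ?_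
      gcongr
      have := norm_sub_le_of_mem_segment hz
      simpa [norm_sub_rev] using this
    have hsplit : f (α y t) - f (α x t) - f' (α x t) (A t (y - x))
        = (f (α y t) - f (α x t) - f' (α x t) (α y t - α x t))
          + f' (α x t) (α y t - α x t - A t (y - x)) := by
      rw [map_sub (f' (α x t)) (α y t - α x t)]; abel
    rw [hsplit]
    refine (norm_add_le _ _).trans ?_
    rw [add_comm]
    gcongr
    · exact ((f' (α x t)).le_opNorm _).trans (by gcongr; exact hK _ (hx t ht').2)
    · refine hrem.trans ?_
      rw [hC]
      calc (K' : ℝ) * ‖α y t - α x t‖ * ‖α y t - α x t‖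
          ≤ K' * (‖y - x‖ * Real.exp (K * T)) * (‖y - x‖ * Real.exp (K * T)) := by
            have := hdist t ht'
            gcongr
        _ = _ := by ring
  -- `gronwallBound` has separate formulas for K = 0 and K ≠ 0; with zero initial value both are
  -- linear in the forcing term.
  have hbound : ∃ D : ℝ, ∀ c : ℝ, gronwallBound 0 K (C * c ^ 2) T = D * c ^ 2 := by
    by_cases hK0 : (K : ℝ) = 0
    · exact ⟨C * T, fun c => by rw [hK0, gronwallBound_K0]; ring⟩
    · exact ⟨C / K * (Real.exp (K * T) - 1), fun c => by
        rw [gronwallBound_of_K_ne_0 hK0]; ring⟩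
  obtain ⟨D, hD⟩ := hbound
  rw [hasFDerivAt_iff_isLittleO]
  refine (Asymptotics.IsBigO.of_bound D (g := fun y => ‖y - x‖ ^ 2) ?_).trans_isLittleO ?_
  · filter_upwards [key] with y hy
    rw [hD] at hy
    simpa using hy
  · have h1 : (fun h : E => ‖h‖ ^ 2) =o[𝓝 0] fun h => h := by
      exact (Asymptotics.isLittleO_norm_pow_id one_lt_two)
    have h2 : Tendsto (fun y => y - x) (𝓝 x) (𝓝 0) := by
      have : ContinuousAt (fun y => y - x) x := by fun_prop
      simpa [ContinuousAt] using this
    exact h1.comp_tendsto h2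

/-- Local flow of a `C²` vector field together with the solutions of the linearized equation. -/
theorem exists_local_flow [CompleteSpace E] {f : E → E} {U : Set E} (hU : IsOpen U)
    (hf : ContDiffOn ℝ 2 f U) {x₀ : E} (hx₀ : x₀ ∈ U) :
    ∃ N ∈ 𝓝 x₀, ∃ ε > (0 : ℝ), ∃ (α : E → ℝ → E) (A : E → ℝ → E →L[ℝ] E),
      ∀ x ∈ N, α x 0 = x ∧ A x 0 = 1 ∧
        (∀ t ∈ Ioo (-ε) ε, HasDerivAt (α x) (f (α x t)) t ∧ α x t ∈ U ∧
          HasDerivAt (A x) (fderiv ℝ f (α x t) ∘L A x t) t) ∧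
        ∀ T ∈ Ico 0 ε, HasFDerivAt (fun y => α y T) (A x T) x := by
  have hfx : ∀ x ∈ U, ContDiffAt ℝ 2 f x := fun x hx => hf.contDiffAt (hU.mem_nhds hx)
  have hf'x : ∀ x ∈ U, ContDiffAt ℝ 1 (fderiv ℝ f) x := fun x hx =>
    (hfx x hx).fderiv_right (m := 1) (by norm_num)
  obtain ⟨K', S, hS, hlip⟩ := (hf'x x₀ hx₀).exists_lipschitzOnWith
  have hbd : ∀ᶠ z in 𝓝 x₀, ‖fderiv ℝ f z‖ < ‖fderiv ℝ f x₀‖ + 1 :=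
    (hf'x x₀ hx₀).continuousAt.norm.eventually (gt_mem_nhds (lt_add_one _))
  obtain ⟨R, hR, hRW⟩ := Metric.mem_nhds_iff.1 (inter_mem (inter_mem hS (hU.mem_nhds hx₀)) hbd)
  set W := ball x₀ R
  -- The equation is coupled with its linearization. F is C¹ because f is C², so one existence
  -- theorem gives solutions of both on a common time interval.
  set F : E × (E →L[ℝ] E) → E × (E →L[ℝ] E) := fun p => (f p.1, fderiv ℝ f p.1 ∘L p.2) with hF
  have hFc : ContDiffAt ℝ 1 F (x₀, 1) := by
    refine ContDiffAt.prodMk ?_ ?_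
    · exact ((hfx x₀ hx₀).of_le (by norm_num)).comp (x₀, (1 : E →L[ℝ] E)) contDiffAt_fst
    · exact ((hf'x x₀ hx₀).comp (x₀, (1 : E →L[ℝ] E)) contDiffAt_fst).clm_comp contDiffAt_snd
  obtain ⟨N, hN, ε, hε, hsol⟩ := exists_solution_mem_nhds hFc
    (W := Prod.fst ⁻¹' W) (continuous_fst.continuousAt.preimage_mem_nhds (ball_mem_nhds _ hR))
  have hN' : {x : E | (x, (1 : E →L[ℝ] E)) ∈ N} ∈ 𝓝 x₀ :=
    (Continuous.prodMk_left (1 : E →L[ℝ] E)).continuousAt.preimage_mem_nhds hN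
  choose! β hβ0 hβ using hsol
  have hint : ∀ x ∈ interior {x : E | (x, (1 : E →L[ℝ] E)) ∈ N}, (x, (1 : E →L[ℝ] E)) ∈ N :=
    fun x hx => (interior_subset hx : x ∈ {x : E | (x, (1 : E →L[ℝ] E)) ∈ N})
  have h1 : ∀ x ∈ interior {x : E | (x, (1 : E →L[ℝ] E)) ∈ N}, ∀ t ∈ Ioo (-ε) ε,
      HasDerivAt (fun t => (β (x, 1) t).1) (f (β (x, 1) t).1) t ∧ (β (x, 1) t).1 ∈ W :=
    fun x hx t ht => ⟨(hβ (x, 1) (hint x hx) t ht).1.fst, (hβ (x, 1) (hint x hx) t ht).2⟩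
  have h2 : ∀ x ∈ interior {x : E | (x, (1 : E →L[ℝ] E)) ∈ N}, ∀ t ∈ Ioo (-ε) ε,
      HasDerivAt (fun t => (β (x, 1) t).2) (fderiv ℝ f (β (x, 1) t).1 ∘L (β (x, 1) t).2) t :=
    fun x hx t ht => (hβ (x, 1) (hint x hx) t ht).1.snd
  -- Differentiability at x needs solutions from all points near x, hence the passage to the
  -- interior.
  refine ⟨interior {x : E | (x, (1 : E →L[ℝ] E)) ∈ N}, interior_mem_nhds.2 hN', ε, hε,
    fun x t => (β (x, 1) t).1, fun x t => (β (x, 1) t).2, fun x hx => ⟨?_, ?_, ?_, ?_⟩⟩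
  · simp [hβ0 _ (hint x hx)]
  · simp [hβ0 _ (hint x hx)]
  · exact fun t ht => ⟨(h1 x hx t ht).1, (hRW (h1 x hx t ht).2).1.2, h2 x hx t ht⟩
  · intro T hT
    have hIcc : Icc 0 T ⊆ Ioo (-ε) ε := fun t ht => ⟨by linarith [ht.1], ht.2.trans_lt hT.2⟩
    refine hasFDerivAt_of_linearized (f := f) (f' := fderiv ℝ f) (convex_ball x₀ R)
      (K := ⟨‖fderiv ℝ f x₀‖ + 1, by positivity⟩) (K' := K')
      (α := fun x t => (β (x, 1) t).1) (A := fun t => (β (x, 1) t).2)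
      (fun z hz => ?_) (fun z hz => (hRW hz).2.le) (hlip.mono fun z hz => (hRW hz).1.1) hT.1
      ?_ (fun t ht => h2 x hx t (hIcc ht)) ?_
    · exact ((hfx z (hRW hz).1.2).differentiableAt (by norm_num)).hasFDerivAt.hasFDerivWithinAt
    · simp [hβ0 _ (hint x hx)]
    · filter_upwards [isOpen_interior.mem_nhds hx] with y hy
      exact ⟨by simp [hβ0 _ (hint y hy)], fun t ht => h1 y hy t (hIcc ht)⟩

end ODE

/-! ### Hamiltonian vector fields on open subsets of a vector space -/

section LinearSpace

variable {E : Type*} [NormedAddCommGroup E] [NormedSpace ℝ E]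

/-- A smooth field of nondegenerate forms and a smooth function define a smooth vector field. -/
theorem contDiffOn_of_form_eq_fderiv [FiniteDimensional ℝ E] {U : Set E} (hU : IsOpen U)
    {B : E → E →L[ℝ] E →L[ℝ] ℝ} (hB : ContDiffOn ℝ ∞ B U)
    (hnd : ∀ z ∈ U, ∀ w, (∀ u, B z u w = 0) → w = 0) {h : E → ℝ} (hh : ContDiffOn ℝ ∞ h U)
    {X : E → E} (hX : ∀ z ∈ U, ∀ u, B z u (X z) = fderiv ℝ h z u) : ContDiffOn ℝ ∞ X U := by
  have : CompleteSpace E := FiniteDimensional.complete ℝ E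
  intro z hz
  have hinj : ∀ z ∈ U, Function.Injective ((B z).flip : E →ₗ[ℝ] E →L[ℝ] ℝ) := by
    intro z hz
    rw [← LinearMap.ker_eq_bot, LinearMap.ker_eq_bot']
    intro w hw
    exact hnd z hz w fun u => by
      have := congrArg (fun L : E →L[ℝ] ℝ => L u) hw
      simpa using this
  have hfr : Module.finrank ℝ E = Module.finrank ℝ (E →L[ℝ] ℝ) := by
    rw [← (LinearMap.toContinuousLinearMap (𝕜 := ℝ) (E := E) (F' := ℝ)).finrank_eq]
    exact Subspace.dual_finrank_eq.symm
  let e : ∀ z ∈ U, E ≃L[ℝ] (E →L[ℝ] ℝ) := fun z hz =>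
    (LinearEquiv.ofInjectiveOfFinrankEq _ (hinj z hz) hfr).toContinuousLinearEquiv
  have he : ∀ z (hz : z ∈ U), (e z hz : E →L[ℝ] E →L[ℝ] ℝ) = (B z).flip := fun z hz => by
    ext w u; rfl
  -- Operator inversion is smooth at invertible operators, so this formula transfers smoothness from
  -- B and dh to X. The flip is there because X occupies the second slot of B.
  have heq : ∀ z ∈ U, X z = ContinuousLinearMap.inverse ((B z).flip) (fderiv ℝ h z) := by
    intro z hz
    rw [← he z hz, ContinuousLinearMap.inverse_equiv]
    apply (e z hz).injective
    rw [ContinuousLinearEquiv.coe_coe, ContinuousLinearEquiv.apply_symm_apply]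
    ext u
    change (e z hz : E →L[ℝ] E →L[ℝ] ℝ) (X z) u = _
    rw [he z hz]
    exact hX z hz u
  have hflip : ContDiffAt ℝ ∞ (fun z => (B z).flip) z := by
    refine ContDiffOn.contDiffAt (s := U) ?_ (hU.mem_nhds hz)
    refine contDiffOn_clm_apply.2 fun w => contDiffOn_clm_apply.2 fun u => ?_
    exact (hB.clm_apply contDiffOn_const).clm_apply contDiffOn_const
  have hinv : ContDiffAt ℝ ∞ (fun z => ContinuousLinearMap.inverse ((B z).flip)) z := by
    refine ContDiffAt.comp z (g := ContinuousLinearMap.inverse) ?_ hflip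
    rw [← he z hz]
    exact contDiffAt_map_inverse _
  have hd : ContDiffAt ℝ ∞ (fderiv ℝ h) z :=
    (hh.contDiffAt (hU.mem_nhds hz)).fderiv_right (by norm_num)
  refine ((hinv.clm_apply hd).congr_of_eventuallyEq ?_).contDiffWithinAt
  filter_upwards [hU.mem_nhds hz] with y hy using heq y hy

/-- The Lie derivative of a closed form along a Hamiltonian vector field vanishes. -/
theorem lieDerivative_eq_zero {U : Set E} (hU : IsOpen U)
    {B : E → E →L[ℝ] E →L[ℝ] ℝ} (hB : ContDiffOn ℝ ∞ B U)
    (halt : ∀ z ∈ U, ∀ u, B z u u = 0)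
    (hcl : ∀ z ∈ U, ∀ u v w, fderiv ℝ B z u v w + fderiv ℝ B z v w u + fderiv ℝ B z w u v = 0)
    {h : E → ℝ} (hh : ContDiffOn ℝ ∞ h U) {X : E → E} (hXs : ContDiffOn ℝ ∞ X U)
    (hX : ∀ z ∈ U, ∀ u, B z u (X z) = fderiv ℝ h z u) {z : E} (hz : z ∈ U) (a c : E) :
    fderiv ℝ B z (X z) a c + B z (fderiv ℝ X z a) c + B z a (fderiv ℝ X z c) = 0 := by
  have hBd : HasFDerivAt B (fderiv ℝ B z) z :=
    ((hB.contDiffAt (hU.mem_nhds hz)).differentiableAt (by norm_num)).hasFDerivAt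
  have hXd : HasFDerivAt X (fderiv ℝ X z) z :=
    ((hXs.contDiffAt (hU.mem_nhds hz)).differentiableAt (by norm_num)).hasFDerivAt
  have hh2 : ContDiffAt ℝ ∞ h z := hh.contDiffAt (hU.mem_nhds hz)
  have hhd : HasFDerivAt (fderiv ℝ h) (fderiv ℝ (fderiv ℝ h) z) z :=
    ((hh2.fderiv_right (m := 1) (by norm_cast)).differentiableAt (by norm_num)).hasFDerivAt
  have hskew : ∀ y ∈ U, ∀ u w, B y u w = - B y w u := fun y hy u w => by
    have := halt y hy (u + w)
    simp only [map_add, add_apply, halt y hy, zero_add, add_zero] at this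
    linarith
  have hskew' : ∀ u v w, fderiv ℝ B z u v w = - fderiv ℝ B z u w v := fun u v w => by
    have h1 : HasFDerivAt (fun y => B y v w) _ z :=
      (hBd.clm_apply (hasFDerivAt_const v z)).clm_apply (hasFDerivAt_const w z)
    have h2 : HasFDerivAt (fun y => - B y w v) _ z :=
      ((hBd.clm_apply (hasFDerivAt_const w z)).clm_apply (hasFDerivAt_const v z)).neg
    have h3 := h1.unique (h2.congr_of_eventuallyEq
      (by filter_upwards [hU.mem_nhds hz] with y hy using hskew y hy v w))
    simpa using congrArg (fun L : E →L[ℝ] ℝ => L u) h3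
  have key : ∀ a c, fderiv ℝ B z c a (X z) + B z a (fderiv ℝ X z c)
      = fderiv ℝ (fderiv ℝ h) z c a := fun a c => by
    have h1 : HasFDerivAt (fun y => B y a (X y)) _ z :=
      (hBd.clm_apply (hasFDerivAt_const a z)).clm_apply hXd
    have h2 : HasFDerivAt (fun y => fderiv ℝ h y a) _ z := hhd.clm_apply (hasFDerivAt_const a z)
    have h3 := h1.unique (h2.congr_of_eventuallyEq
      (by filter_upwards [hU.mem_nhds hz] with y hy using hX y hy a))
    have := congrArg (fun L : E →L[ℝ] ℝ => L c) h3
    simp at this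
    linarith
  -- Cartan's formula in coordinates: `key` differentiates B(a, X) = dh(a). Antisymmetrizing in a
  -- and c removes the Hessian of h, and closedness turns the two remaining derivatives of B into
  -- its derivative along X.
  have hsymm : fderiv ℝ (fderiv ℝ h) z c a = fderiv ℝ (fderiv ℝ h) z a c :=
    (hh2.isSymmSndFDerivAt (by simp; norm_cast)).eq c a
  have e1 := key a c
  have e2 := key c a
  have e3 := hcl z hz (X z) a c
  have e4 := hskew' c (X z) a
  have e5 := hskew z hz (fderiv ℝ X z a) c
  linarith

/-- The linearized Hamiltonian flow preserves the form. -/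
theorem form_linearized_eq {U : Set E}
    {B : E → E →L[ℝ] E →L[ℝ] ℝ} (hBd : ∀ z ∈ U, DifferentiableAt ℝ B z) {X : E → E}
    (hL : ∀ z ∈ U, ∀ a c,
      fderiv ℝ B z (X z) a c + B z (fderiv ℝ X z a) c + B z a (fderiv ℝ X z c) = 0)
    {α : ℝ → E} {A : ℝ → E →L[ℝ] E} {ε : ℝ}
    (hα : ∀ t ∈ Ioo (-ε) ε, HasDerivAt α (X (α t)) t ∧ α t ∈ U ∧
      HasDerivAt A (fderiv ℝ X (α t) ∘L A t) t) {T : ℝ} (hT : T ∈ Ico 0 ε) (u w : E) :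
    B (α T) (A T u) (A T w) = B (α 0) (A 0 u) (A 0 w) := by
  have hIcc : Icc 0 T ⊆ Ioo (-ε) ε := fun t ht => ⟨by linarith [ht.1, hT.1, hT.2], ht.2.trans_lt hT.2⟩
  have hd : ∀ t ∈ Ioo (-ε) ε, HasDerivAt (fun t => B (α t) (A t u) (A t w)) 0 t := by
    intro t ht
    obtain ⟨h1, h2, h3⟩ := hα t ht
    have hB : HasDerivAt (fun t => B (α t)) (fderiv ℝ B (α t) (X (α t))) t := by
      have h4 : HasFDerivAt B (fderiv ℝ B (α t)) (α t) := (hBd _ h2).hasFDerivAt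
      exact HasFDerivAt.comp_hasDerivAt (F := E) (E := E →L[ℝ] E →L[ℝ] ℝ) t h4 h1
    refine ((hB.clm_apply (h3.clm_apply (hasDerivAt_const t u))).clm_apply
      (h3.clm_apply (hasDerivAt_const t w))).congr_deriv ?_
    have := hL _ h2 (A t u) (A t w)
    simp
    linarith
  exact constant_of_has_deriv_right_zero
    (fun t ht => (hd t (hIcc ht)).continuousAt.continuousWithinAt)
    (fun t ht => (hd t (hIcc (Ico_subset_Icc_self ht))).hasDerivWithinAt) T ⟨hT.1, le_rfl⟩

end LinearSpace

/-! ### The symplectic form and the Hamiltonian vector field in charts -/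

section Chart

variable {E : Type*} [NormedAddCommGroup E] [NormedSpace ℝ E]
  {M : Type*} [TopologicalSpace M] [ChartedSpace E M]

/-- Every tangent space is the model space E by definition; typing the vectors in E allows a change
of base point without transport. -/
theorem SymplecticForm.congr_point (Ω : SymplecticForm E M) {x y : M} (h : x = y) (u w : E) :
    Ω.toFun x u w = Ω.toFun y u w := by
  subst h; rfl

theorem SymplecticForm.neg_swap (Ω : SymplecticForm E M) (x : M) (u w : TangentSpace 𝓘(ℝ, E) x) :
    Ω.toFun x u w = - Ω.toFun x w u := by
  have halt : LinearMap.IsAlt (Ω.toFun x) := Ω.alternating x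
  exact (halt.neg w u).symm

theorem mfderiv_chart_symm_apply_mfderiv [IsManifold 𝓘(ℝ, E) ∞ M] {e : OpenPartialHomeomorph M E}
    (he : e ∈ atlas E M) {x : M} (hx : x ∈ e.source) {z : E} (hz : e x = z) (u : E) :
    (mfderiv 𝓘(ℝ, E) 𝓘(ℝ, E) e.symm z (mfderiv 𝓘(ℝ, E) 𝓘(ℝ, E) e x u) : E) = u := by
  subst hz
  have : IsManifold 𝓘(ℝ, E) 1 M := .of_le (n := ∞) (by norm_cast)
  exact DFunLike.congr_fun
    ((mdifferentiable_of_mem_atlas (I := 𝓘(ℝ, E)) he).symm_comp_deriv hx) u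

theorem mfderiv_chart_apply_mfderiv_symm [IsManifold 𝓘(ℝ, E) ∞ M] {e : OpenPartialHomeomorph M E}
    (he : e ∈ atlas E M) {z : E} (hz : z ∈ e.target) (u : E) :
    (mfderiv 𝓘(ℝ, E) 𝓘(ℝ, E) e (e.symm z) (mfderiv 𝓘(ℝ, E) 𝓘(ℝ, E) e.symm z u) : E) = u := by
  have : IsManifold 𝓘(ℝ, E) 1 M := .of_le (n := ∞) (by norm_cast)
  exact DFunLike.congr_fun
    ((mdifferentiable_of_mem_atlas (I := 𝓘(ℝ, E)) he).comp_symm_deriv hz) u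

/-- A vector field in a chart. -/
def chartVector (X : ∀ x : M, TangentSpace 𝓘(ℝ, E) x) (e : OpenPartialHomeomorph M E) (z : E) : E :=
  mfderiv 𝓘(ℝ, E) 𝓘(ℝ, E) e (e.symm z) (X (e.symm z))

theorem chartVector_apply (X : ∀ x : M, TangentSpace 𝓘(ℝ, E) x) (e : OpenPartialHomeomorph M E)
    {x : M} (hx : x ∈ e.source) :
    chartVector X e (e x) = (mfderiv 𝓘(ℝ, E) 𝓘(ℝ, E) e x (X x) : E) := by
  have : ∀ y : M, y = x → (mfderiv 𝓘(ℝ, E) 𝓘(ℝ, E) e y (X y) : E)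
      = mfderiv 𝓘(ℝ, E) 𝓘(ℝ, E) e x (X x) := by
    rintro _ rfl; rfl
  exact this _ (e.left_inv hx)

theorem contDiffOn_comp_chart_symm [IsManifold 𝓘(ℝ, E) ∞ M] {H : M → ℝ} (hH : ContMDiff 𝓘(ℝ, E) 𝓘(ℝ, ℝ) ∞ H)
    {e : OpenPartialHomeomorph M E} (he : e ∈ atlas E M) :
    ContDiffOn ℝ ∞ (H ∘ e.symm) e.target := by
  rw [← contMDiffOn_iff_contDiffOn]
  exact hH.comp_contMDiffOn (contMDiffOn_symm_of_mem_maximalAtlas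
    (IsManifold.subset_maximalAtlas he))

variable [FiniteDimensional ℝ E]

/-- The symplectic form in a chart, as a field of continuous bilinear forms. -/
def chartForm (Ω : SymplecticForm E M) (e : OpenPartialHomeomorph M E) (z : E) :
    E →L[ℝ] E →L[ℝ] ℝ :=
  LinearMap.toContinuousLinearMap
    ((LinearMap.toContinuousLinearMap (𝕜 := ℝ) (E := E) (F' := ℝ)).toLinearMap ∘ₗ
      (Ω.toFun (e.symm z)).compl₁₂
        (mfderiv 𝓘(ℝ, E) 𝓘(ℝ, E) e.symm z : E →L[ℝ] TangentSpace 𝓘(ℝ, E) (e.symm z)).toLinearMap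
        (mfderiv 𝓘(ℝ, E) 𝓘(ℝ, E) e.symm z : E →L[ℝ] TangentSpace 𝓘(ℝ, E) (e.symm z)).toLinearMap)

theorem contDiffOn_chartForm (Ω : SymplecticForm E M) {e : OpenPartialHomeomorph M E}
    (he : e ∈ atlas E M) : ContDiffOn ℝ ∞ (chartForm Ω e) e.target :=
  contDiffOn_clm_apply.2 fun u => contDiffOn_clm_apply.2 fun w => Ω.smooth e he u w

theorem chartForm_closed (Ω : SymplecticForm E M) {e : OpenPartialHomeomorph M E}
    (he : e ∈ atlas E M) {z : E} (hz : z ∈ e.target) (u v w : E) :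
    fderiv ℝ (chartForm Ω e) z u v w + fderiv ℝ (chartForm Ω e) z v w u
      + fderiv ℝ (chartForm Ω e) z w u v = 0 := by
  have hd : HasFDerivAt (chartForm Ω e) (fderiv ℝ (chartForm Ω e) z) z :=
    (((contDiffOn_chartForm Ω he).contDiffAt (e.open_target.mem_nhds hz)).differentiableAt
      (by norm_num)).hasFDerivAt
  have key : ∀ a b c, fderiv ℝ (coeffInChart Ω.toFun e b c) z a
      = fderiv ℝ (chartForm Ω e) z a b c := fun a b c => by
    have h1 : HasFDerivAt (coeffInChart Ω.toFun e b c) _ z :=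
      (hd.clm_apply (hasFDerivAt_const b z)).clm_apply (hasFDerivAt_const c z)
    rw [h1.fderiv]
    simp
  have := Ω.closed e he z hz u v w
  rwa [key, key, key] at this

variable [IsManifold 𝓘(ℝ, E) ∞ M]

theorem chartForm_mfderiv (Ω : SymplecticForm E M) {e : OpenPartialHomeomorph M E}
    (he : e ∈ atlas E M) {z : E} (hz : z ∈ e.target) (u w : E) :
    chartForm Ω e z u (mfderiv 𝓘(ℝ, E) 𝓘(ℝ, E) e (e.symm z) w : E)
      = Ω.toFun (e.symm z) (mfderiv 𝓘(ℝ, E) 𝓘(ℝ, E) e.symm z u) w := by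
  exact congrArg (Ω.toFun (e.symm z) (mfderiv 𝓘(ℝ, E) 𝓘(ℝ, E) e.symm z u))
    (mfderiv_chart_symm_apply_mfderiv he (e.map_target hz) (e.right_inv hz) w)

theorem chartForm_nondegenerate (Ω : SymplecticForm E M) {e : OpenPartialHomeomorph M E}
    (he : e ∈ atlas E M) {z : E} (hz : z ∈ e.target) (w : E)
    (hw : ∀ u, chartForm Ω e z u w = 0) : w = 0 := by
  have h0 : mfderiv 𝓘(ℝ, E) 𝓘(ℝ, E) e.symm z w = 0 := by
    refine Ω.nondegenerate _ _ fun u => ?_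
    rw [Ω.neg_swap, neg_eq_zero]
    have h1 := hw (mfderiv 𝓘(ℝ, E) 𝓘(ℝ, E) e (e.symm z) u)
    refine Eq.trans (congrArg (fun a => Ω.toFun (e.symm z) a (mfderiv 𝓘(ℝ, E) 𝓘(ℝ, E) e.symm z w))
      (mfderiv_chart_symm_apply_mfderiv he (e.map_target hz) (e.right_inv hz) u).symm) h1
  rw [← mfderiv_chart_apply_mfderiv_symm he hz w, h0]
  exact map_zero _

theorem chartForm_chartVector (Ω : SymplecticForm E M) {H : M → ℝ}
    (hH : ContMDiff 𝓘(ℝ, E) 𝓘(ℝ, ℝ) ∞ H) {e : OpenPartialHomeomorph M E}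
    (he : e ∈ atlas E M) {z : E} (hz : z ∈ e.target) (u : E) :
    chartForm Ω e z u (chartVector (hamiltonianVectorField Ω H) e z)
      = fderiv ℝ (H ∘ e.symm) z u := by
  have : IsManifold 𝓘(ℝ, E) 1 M := .of_le (n := ∞) (by norm_cast)
  refine (chartForm_mfderiv Ω he hz u _).trans ?_
  rw [← hamiltonianVectorField_spec, ← mfderiv_eq_fderiv,
    mfderiv_comp z ((hH _).mdifferentiableAt (by norm_num)) (mdifferentiableAt_atlas_symm he hz)]
  rfl

theorem contDiffOn_chartVector (Ω : SymplecticForm E M) {H : M → ℝ}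
    (hH : ContMDiff 𝓘(ℝ, E) 𝓘(ℝ, ℝ) ∞ H) {e : OpenPartialHomeomorph M E} (he : e ∈ atlas E M) :
    ContDiffOn ℝ ∞ (chartVector (hamiltonianVectorField Ω H) e) e.target :=
  contDiffOn_of_form_eq_fderiv e.open_target (contDiffOn_chartForm Ω he)
    (fun _ hz w => chartForm_nondegenerate Ω he hz w) (contDiffOn_comp_chart_symm hH he)
    (fun _ hz u => chartForm_chartVector Ω hH he hz u)

/-- The Hamiltonian vector field of a smooth function is smooth. -/
theorem contMDiff_hamiltonianVectorField (Ω : SymplecticForm E M) {H : M → ℝ}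
    (hH : ContMDiff 𝓘(ℝ, E) 𝓘(ℝ, ℝ) ∞ H) :
    ContMDiff 𝓘(ℝ, E) (𝓘(ℝ, E).tangent) 1
      (fun x => (⟨x, hamiltonianVectorField Ω H x⟩ : TangentBundle 𝓘(ℝ, E) M)) := by
  have : IsManifold 𝓘(ℝ, E) 1 M := .of_le (n := ∞) (by norm_cast)
  have : IsManifold 𝓘(ℝ, E) (1 + 1) M := .of_le (n := ∞) (by norm_cast)
  intro x₀
  rw [Bundle.contMDiffAt_section]
  have hsrc : (chartAt E x₀).source ∈ 𝓝 x₀ := chart_source_mem_nhds E x₀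
  have h1 : ContMDiffAt 𝓘(ℝ, E) 𝓘(ℝ, E) 1
      (chartVector (hamiltonianVectorField Ω H) (chartAt E x₀) ∘ chartAt E x₀) x₀ := by
    refine ContMDiffAt.comp x₀ (I' := 𝓘(ℝ, E)) ?_ ?_
    · exact (((contDiffOn_chartVector Ω hH (chart_mem_atlas E x₀)).contDiffAt
        ((chartAt E x₀).open_target.mem_nhds (mem_chart_target E x₀))).of_le
          (by norm_cast)).contMDiffAt
    · exact (contMDiffOn_chart.contMDiffAt hsrc)
  refine h1.congr_of_eventuallyEq ?_
  filter_upwards [hsrc] with x hx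
  -- In the trivialization of the tangent bundle at x₀, the fibre coordinate of the field is its
  -- chart representative.
  have h2 := TangentBundle.continuousLinearMapAt_trivializationAt (I := 𝓘(ℝ, E)) hx
  have h3 := DFunLike.congr_fun h2 (hamiltonianVectorField Ω H x)
  rw [Bundle.Trivialization.continuousLinearMapAt_apply,
    Bundle.Trivialization.coe_linearMapAt_of_mem _ (by simpa using hx)] at h3
  exact h3.trans (chartVector_apply _ _ hx).symm

end Chart

/-! ### Uniqueness and composition for the partially defined flow -/

section Flow

variable {E : Type*} [NormedAddCommGroup E] [NormedSpace ℝ E]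
  {M : Type*} [TopologicalSpace M] [ChartedSpace E M]

theorem congr_isMIntegralCurveAt {X : ∀ x : M, TangentSpace 𝓘(ℝ, E) x} {γ δ : ℝ → M} {t : ℝ}
    (h : IsMIntegralCurveAt (I := 𝓘(ℝ, E)) γ X t) (hγδ : γ =ᶠ[𝓝 t] δ) :
    IsMIntegralCurveAt (I := 𝓘(ℝ, E)) δ X t := by
  filter_upwards [h, hγδ.eventuallyEq_nhds] with s hs hs'
  have h1 := hs.congr_of_eventuallyEq hs'.symm
  have h2 : ∀ p q : M, p = q → ((1 : ℝ →L[ℝ] ℝ).smulRight (X p : E) : ℝ →L[ℝ] E)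
      = (1 : ℝ →L[ℝ] ℝ).smulRight (X q : E) := by
    rintro p _ rfl; rfl
  exact h1.congr_mfderiv (h2 _ _ hs'.eq_of_nhds)

theorem IsSolutionUpTo.shift {X : ∀ x : M, TangentSpace 𝓘(ℝ, E) x} {v : ℝ → M}
    (hv : IsMIntegralCurve (I := 𝓘(ℝ, E)) v X) (s T : ℝ) :
    IsSolutionUpTo X (v s) T (fun t => v (t + s)) :=
  ⟨by simp, min 0 T - 1, max 0 T + 1, by constructor <;> grind, by constructor <;> grind,
    (hv.comp_add s).isMIntegralCurveOn _⟩

variable [IsManifold 𝓘(ℝ, E) 1 M]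

/-- A `C¹` vector field. -/
abbrev IsC1VectorField (X : ∀ x : M, TangentSpace 𝓘(ℝ, E) x) : Prop :=
  ContMDiff 𝓘(ℝ, E) (𝓘(ℝ, E).tangent) 1 (fun x => (⟨x, X x⟩ : TangentBundle 𝓘(ℝ, E) M))

variable {X : ∀ x : M, TangentSpace 𝓘(ℝ, E) x}

theorem IsSolutionUpTo.glue (hX : IsC1VectorField X) {x : M} {T T' : ℝ} (hT : 0 ≤ T) (hT' : 0 ≤ T')
    {γ γ' : ℝ → M} (h : IsSolutionUpTo X x T γ) (h' : IsSolutionUpTo X (γ T) T' γ') :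
    IsSolutionUpTo X x (T + T') (fun t => if t < T then γ t else γ' (t - T)) := by
  obtain ⟨h0, a, b, h0m, htm, hc⟩ := h
  obtain ⟨h0', a', b', h0m', htm', hc'⟩ := h'
  refine ⟨?_, a, T + b', ⟨h0m.1, by linarith [h0m'.2]⟩,
    ⟨by linarith [h0m.1], by linarith [htm'.2]⟩, ?_⟩
  · by_cases hT0 : 0 < T
    · simp [hT0, h0]
    · obtain rfl : T = 0 := le_antisymm (not_lt.1 hT0) hT
      simp [h0', h0]
  · have h1 : ∀ t ∈ Ioo a b, IsMIntegralCurveAt (I := 𝓘(ℝ, E)) γ X t := fun t ht =>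
      hc.isMIntegralCurveAt (isOpen_Ioo.mem_nhds ht)
    have h2 : ∀ t, t - T ∈ Ioo a' b' →
        IsMIntegralCurveAt (I := 𝓘(ℝ, E)) (fun t => γ' (t - T)) X t := fun t ht => by
      have := (isMIntegralCurveAt_comp_sub (dt := T)).2
        (hc'.isMIntegralCurveAt (isOpen_Ioo.mem_nhds ht))
      rwa [sub_add_cancel] at this
    refine IsMIntegralCurveAt.isMIntegralCurveOn fun t ht => ?_
    rcases lt_trichotomy t T with hlt | rfl | hgt
    · refine congr_isMIntegralCurveAt (h1 t ⟨ht.1, hlt.trans htm.2⟩) ?_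
      filter_upwards [gt_mem_nhds hlt] with s hs
      rw [if_pos hs]
    · have h3 := h1 t htm
      have h4 := h2 t (by simpa using h0m')
      -- At the seam both pieces are integral curves through the same point; local uniqueness makes
      -- them agree nearby, so no corner arises.
      have heq : γ =ᶠ[𝓝 t] fun s => γ' (s - t) :=
        isMIntegralCurveAt_eventuallyEq_of_contMDiffAt_boundaryless (hX _) h3 h4 (by simp [h0'])
      refine congr_isMIntegralCurveAt h3 ?_
      filter_upwards [heq] with s hs
      split_ifs
      · rfl
      · exact hs
    · refine congr_isMIntegralCurveAt (h2 t ⟨?_, ?_⟩) ?_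
      · linarith [h0m'.1]
      · linarith [ht.2]
      · filter_upwards [lt_mem_nhds hgt] with s hs
        rw [if_neg (not_lt.2 hs.le)]

variable [T2Space M]

/-- `flow` chooses a solution arbitrarily; uniqueness on the common interval, which uses that M is
Hausdorff, removes the choice. -/
theorem flow_eq (hX : IsC1VectorField X) {x : M} {t : ℝ} {γ : ℝ → M}
    (h : IsSolutionUpTo X x t γ) : flow X t x = γ t := by
  have hex : ∃ γ : ℝ → M, IsSolutionUpTo X x t γ := ⟨γ, h⟩
  rw [flow, dif_pos hex]
  obtain ⟨h0, a, b, h0m, htm, hc⟩ := h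
  obtain ⟨h0', a', b', h0m', htm', hc'⟩ := hex.choose_spec
  refine isMIntegralCurveOn_Ioo_eqOn_of_contMDiff_boundaryless (t₀ := 0)
    (a := max a a') (b := min b b') ?_ hX
    (hc'.mono (Ioo_subset_Ioo (le_max_right _ _) (min_le_right _ _)))
    (hc.mono (Ioo_subset_Ioo (le_max_left _ _) (min_le_left _ _))) (h0'.trans h0.symm) ?_
  · exact ⟨max_lt h0m.1 h0m'.1, lt_min h0m.2 h0m'.2⟩
  · exact ⟨max_lt htm.1 htm'.1, lt_min htm.2 htm'.2⟩

theorem flow_add (hX : IsC1VectorField X) {x : M} {T T' : ℝ} (hT : 0 ≤ T) (hT' : 0 ≤ T')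
    (h : ∃ γ, IsSolutionUpTo X x T γ) (h' : ∃ γ, IsSolutionUpTo X (flow X T x) T' γ) :
    (∃ γ, IsSolutionUpTo X x (T + T') γ) ∧ flow X (T + T') x = flow X T' (flow X T x) := by
  obtain ⟨γ, hγ⟩ := h
  obtain ⟨γ', hγ'⟩ := h'
  have h1 := IsSolutionUpTo.glue hX hT hT' hγ (by rwa [flow_eq hX hγ] at hγ')
  refine ⟨⟨_, h1⟩, ?_⟩
  rw [flow_eq hX h1, flow_eq hX hγ']
  simp [not_lt.2 hT']

theorem flow_integralCurve (hX : IsC1VectorField X) {v : ℝ → M}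
    (hv : IsMIntegralCurve (I := 𝓘(ℝ, E)) v X) (s T : ℝ) : flow X T (v s) = v (s + T) := by
  rw [flow_eq hX (IsSolutionUpTo.shift hv s T), add_comm]

/-- Near `x` the flow of `X` is defined up to time `T`; it is differentiable at `x`, and its
differential at `x` preserves `Ω`. -/
structure FlowIsSymplecticAt (Ω : SymplecticForm E M) (X : ∀ x : M, TangentSpace 𝓘(ℝ, E) x) (T : ℝ)
    (x : M) : Prop where
  exists_solution : ∀ᶠ y in 𝓝 x, ∃ γ, IsSolutionUpTo X y T γ
  mdifferentiableAt : MDifferentiableAt 𝓘(ℝ, E) 𝓘(ℝ, E) (flow X T) x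
  form_eq : ∀ u w : TangentSpace 𝓘(ℝ, E) x,
    Ω.toFun (flow X T x) (mfderiv 𝓘(ℝ, E) 𝓘(ℝ, E) (flow X T) x u)
      (mfderiv 𝓘(ℝ, E) 𝓘(ℝ, E) (flow X T) x w) = Ω.toFun x u w

theorem FlowIsSymplecticAt.flow_add_eventuallyEq {Ω : SymplecticForm E M}
    (hX : IsC1VectorField X) {T T' : ℝ} (hT : 0 ≤ T)
    (hT' : 0 ≤ T') {x : M} (h : FlowIsSymplecticAt Ω X T x)
    (h' : FlowIsSymplecticAt Ω X T' (flow X T x)) :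
    ∀ᶠ y in 𝓝 x, (∃ γ, IsSolutionUpTo X y (T + T') γ) ∧
      flow X (T + T') y = flow X T' (flow X T y) := by
  filter_upwards [h.exists_solution, h.mdifferentiableAt.continuousAt.eventually h'.exists_solution]
    with y hy hy' using flow_add hX hT hT' hy hy'

theorem FlowIsSymplecticAt.mfderiv_flow_add {Ω : SymplecticForm E M}
    (hX : IsC1VectorField X) {T T' : ℝ} (hT : 0 ≤ T)
    (hT' : 0 ≤ T') {x : M} (h : FlowIsSymplecticAt Ω X T x)
    (h' : FlowIsSymplecticAt Ω X T' (flow X T x)) (u : E) :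
    (mfderiv 𝓘(ℝ, E) 𝓘(ℝ, E) (flow X (T + T')) x u : E) =
      mfderiv 𝓘(ℝ, E) 𝓘(ℝ, E) (flow X T') (flow X T x)
        (mfderiv 𝓘(ℝ, E) 𝓘(ℝ, E) (flow X T) x u) := by
  have heq : flow X (T + T') =ᶠ[𝓝 x] flow X T' ∘ flow X T :=
    (h.flow_add_eventuallyEq hX hT hT' h').mono fun y hy => hy.2
  have h1 := (h'.mdifferentiableAt.hasMFDerivAt.comp x
    h.mdifferentiableAt.hasMFDerivAt).congr_of_eventuallyEq heq
  exact DFunLike.congr_fun h1.mfderiv u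

/-- This extends short-time statements to long times by composing flow maps. -/
theorem FlowIsSymplecticAt.add {Ω : SymplecticForm E M}
    (hX : IsC1VectorField X) {T T' : ℝ} (hT : 0 ≤ T)
    (hT' : 0 ≤ T') {x : M} (h : FlowIsSymplecticAt Ω X T x)
    (h' : FlowIsSymplecticAt Ω X T' (flow X T x)) : FlowIsSymplecticAt Ω X (T + T') x := by
  have hev := h.flow_add_eventuallyEq hX hT hT' h'
  refine ⟨hev.mono fun y hy => hy.1, ?_, fun u w => ?_⟩
  · exact (h'.mdifferentiableAt.comp x h.mdifferentiableAt).congr_of_eventuallyEq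
      (hev.mono fun y hy => hy.2)
  · rw [← h.form_eq, ← h'.form_eq]
    have hu := h.mfderiv_flow_add hX hT hT' h' u
    have hw := h.mfderiv_flow_add hX hT hT' h' w
    refine (Ω.congr_point hev.self_of_nhds.2 _ _).trans ?_
    exact congrArg₂ (fun a b : E => Ω.toFun (flow X T' (flow X T x)) a b) hu hw

end Flow

/-! ### The Hamiltonian flow is differentiable and symplectic along the orbit -/

section HamiltonianFlow

variable {E : Type*} [NormedAddCommGroup E] [NormedSpace ℝ E]
  {M : Type*} [TopologicalSpace M] [ChartedSpace E M] [IsManifold 𝓘(ℝ, E) ∞ M]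

theorem hasMFDerivAt_chart_symm_comp {X : ∀ x : M, TangentSpace 𝓘(ℝ, E) x}
    {e : OpenPartialHomeomorph M E} (he : e ∈ atlas E M) {α : ℝ → E} {t : ℝ}
    (hα : HasDerivAt α (chartVector X e (α t)) t) (ht : α t ∈ e.target) :
    HasMFDerivAt 𝓘(ℝ, ℝ) 𝓘(ℝ, E) (e.symm ∘ α) t
      ((1 : ℝ →L[ℝ] ℝ).smulRight (X (e.symm (α t)))) := by
  have : IsManifold 𝓘(ℝ, E) 1 M := .of_le (n := ∞) (by norm_cast)
  refine ((mdifferentiableAt_atlas_symm he ht).hasMFDerivAt.comp t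
    hα.hasFDerivAt.hasMFDerivAt).congr_mfderiv ?_
  refine ContinuousLinearMap.ext_ring ?_
  have h1 := mfderiv_chart_symm_apply_mfderiv he (e.map_target ht) (e.right_inv ht)
    (X (e.symm (α t)))
  change (mfderiv 𝓘(ℝ, E) 𝓘(ℝ, E) e.symm (α t) ((1 : ℝ) • chartVector X e (α t)) : E)
    = (1 : ℝ) • (X (e.symm (α t)) : E)
  rw [one_smul, one_smul]
  exact h1

variable [FiniteDimensional ℝ E] [T2Space M]

/-- For short times the Hamiltonian flow is defined, differentiable and symplectic. -/
theorem exists_nhds_flowIsSymplecticAt (Ω : SymplecticForm E M) {H : M → ℝ}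
    (hH : ContMDiff 𝓘(ℝ, E) 𝓘(ℝ, ℝ) ∞ H) (x₀ : M) :
    ∃ N ∈ 𝓝 x₀, ∃ ε > (0 : ℝ), ∀ x ∈ N, ∀ T ∈ Ico 0 ε,
      FlowIsSymplecticAt Ω (hamiltonianVectorField Ω H) T x := by
  have : CompleteSpace E := FiniteDimensional.complete ℝ E
  have : IsManifold 𝓘(ℝ, E) 1 M := .of_le (n := ∞) (by norm_cast)
  set X := hamiltonianVectorField Ω H with hXdef
  have hX : IsC1VectorField X := contMDiff_hamiltonianVectorField Ω hH
  set e := chartAt E x₀ with hedef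
  have he : e ∈ atlas E M := chart_mem_atlas E x₀
  have hXc : ContDiffOn ℝ ∞ (chartVector X e) e.target := contDiffOn_chartVector Ω hH he
  have hB := contDiffOn_chartForm Ω he
  obtain ⟨N, hN, ε, hε, α, A, hαA⟩ := exists_local_flow e.open_target
    (hXc.of_le (by norm_cast)) (mem_chart_target E x₀)
  have hNint : interior N ∈ 𝓝 (e x₀) := interior_mem_nhds.2 hN
  have hopen : IsOpen (e.source ∩ e ⁻¹' interior N) := e.isOpen_inter_preimage isOpen_interior
  have hsol : ∀ y ∈ e.source ∩ e ⁻¹' interior N, ∀ T ∈ Ico 0 ε,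
      IsSolutionUpTo X y T (e.symm ∘ α (e y)) := by
    intro y hy T hT
    obtain ⟨h0, -, hd, -⟩ := hαA (e y) (interior_subset hy.2)
    refine ⟨by rw [Function.comp_apply, h0, e.left_inv hy.1], -ε, ε, ⟨by linarith, hε⟩,
      ⟨by linarith [hT.1], hT.2⟩, fun t ht => ?_⟩
    exact (hasMFDerivAt_chart_symm_comp he (hd t ht).1 (hd t ht).2.1).hasMFDerivWithinAt
  refine ⟨_, hopen.mem_nhds ⟨mem_chart_source E x₀, (mem_of_mem_nhds hNint : e x₀ ∈ interior N)⟩, ε, hε,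
    fun x hx T hT => ?_⟩
  obtain ⟨h0, hA0, hd, hdiff⟩ := hαA (e x) (interior_subset hx.2)
  have hTm : T ∈ Ioo (-ε) ε := ⟨by linarith [hT.1], hT.2⟩
  have heq : flow X T =ᶠ[𝓝 x] e.symm ∘ (fun z => α z T) ∘ e := by
    filter_upwards [hopen.mem_nhds hx] with y hy
    exact flow_eq hX (hsol y hy T hT)
  have hder : HasMFDerivAt 𝓘(ℝ, E) 𝓘(ℝ, E) (e.symm ∘ (fun z => α z T) ∘ e) x
      ((mfderiv 𝓘(ℝ, E) 𝓘(ℝ, E) e.symm (α (e x) T)).comp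
        ((A (e x) T : E →L[ℝ] E).comp (mfderiv 𝓘(ℝ, E) 𝓘(ℝ, E) e x))) :=
    HasMFDerivAt.comp x (mdifferentiableAt_atlas_symm he (hd T hTm).2.1).hasMFDerivAt
      ((hdiff T hT).hasMFDerivAt.comp x (mdifferentiableAt_atlas he hx.1).hasMFDerivAt)
  have hflow := hder.congr_of_eventuallyEq heq
  refine ⟨?_, hflow.mdifferentiableAt, fun u w => ?_⟩
  · filter_upwards [hopen.mem_nhds hx] with y hy using ⟨_, hsol y hy T hT⟩
  · have h1 := form_linearized_eq (U := e.target) (B := chartForm Ω e) (X := chartVector X e)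
      (fun z hz => (hB.contDiffAt (e.open_target.mem_nhds hz)).differentiableAt (by norm_num))
      (fun z hz a c => lieDerivative_eq_zero e.open_target hB
        (fun z _ u => Ω.alternating _ _)
        (fun z hz u v w => chartForm_closed Ω he hz u v w) (contDiffOn_comp_chart_symm hH he)
        hXc (fun z hz u => chartForm_chartVector Ω hH he hz u) hz a c)
      (α := α (e x)) (A := A (e x)) hd hT
      (mfderiv 𝓘(ℝ, E) 𝓘(ℝ, E) e x u) (mfderiv 𝓘(ℝ, E) 𝓘(ℝ, E) e x w)
    have h2 : ∀ u : E, (mfderiv 𝓘(ℝ, E) 𝓘(ℝ, E) (flow X T) x u : E)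
        = mfderiv 𝓘(ℝ, E) 𝓘(ℝ, E) e.symm (α (e x) T)
          (A (e x) T (mfderiv 𝓘(ℝ, E) 𝓘(ℝ, E) e x u)) :=
      fun u => DFunLike.congr_fun hflow.mfderiv u
    refine (Ω.congr_point heq.eq_of_nhds _ _).trans ?_
    refine (congrArg₂ (fun a b : E => Ω.toFun (e.symm (α (e x) T)) a b) (h2 u) (h2 w)).trans ?_
    refine h1.trans ?_
    rw [h0, hA0]
    refine (Ω.congr_point (e.left_inv hx.1) _ _).trans ?_
    exact congrArg₂ (fun a b : E => Ω.toFun x a b)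
      (mfderiv_chart_symm_apply_mfderiv he hx.1 rfl u)
      (mfderiv_chart_symm_apply_mfderiv he hx.1 rfl w)

/-- The Hamiltonian flow is defined, differentiable and symplectic along a periodic orbit. -/
theorem IsPeriodicOrbit.flowIsSymplecticAt {Ω : SymplecticForm E M} {H : M → ℝ}
    (hH : ContMDiff 𝓘(ℝ, E) 𝓘(ℝ, ℝ) ∞ H) {τ : ℝ} {v : ℝ → M} (hv : IsPeriodicOrbit Ω H τ v)
    (s : ℝ) {T : ℝ} (hT : 0 ≤ T) :
    FlowIsSymplecticAt Ω (hamiltonianVectorField Ω H) T (v s) := by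
  have : IsManifold 𝓘(ℝ, E) 1 M := .of_le (n := ∞) (by norm_cast)
  have hX := contMDiff_hamiltonianVectorField Ω hH
  have hK : IsCompact (range v) := by
    rw [← hv.periodic.image_Icc hv.period_pos 0]
    exact isCompact_Icc.image hv.integralCurve.continuous
  -- Compactness of the orbit yields one existence time ε for all of its points; T is then cut into
  -- n steps shorter than ε, all starting on the orbit.
  obtain ⟨ε, hε, hεK⟩ : ∃ ε > (0 : ℝ), ∀ x ∈ range v, ∀ T ∈ Ico 0 ε,
      FlowIsSymplecticAt Ω (hamiltonianVectorField Ω H) T x := by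
    refine hK.induction_on (p := fun S => ∃ ε > (0 : ℝ), ∀ x ∈ S, ∀ T ∈ Ico 0 ε,
      FlowIsSymplecticAt Ω (hamiltonianVectorField Ω H) T x) ⟨1, one_pos, by simp⟩ ?_ ?_ ?_
    · rintro S S' hSS' ⟨ε, hε, h⟩
      exact ⟨ε, hε, fun x hx => h x (hSS' hx)⟩
    · rintro S S' ⟨ε, hε, h⟩ ⟨ε', hε', h'⟩
      refine ⟨min ε ε', lt_min hε hε', ?_⟩
      rintro x (hx | hx) T hT
      · exact h x hx T ⟨hT.1, hT.2.trans_le (min_le_left _ _)⟩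
      · exact h' x hx T ⟨hT.1, hT.2.trans_le (min_le_right _ _)⟩
    · intro x _
      obtain ⟨N, hN, ε, hε, h⟩ := exists_nhds_flowIsSymplecticAt Ω hH x
      exact ⟨N, mem_nhdsWithin_of_mem_nhds hN, ε, hε, h⟩
  obtain ⟨n, hn⟩ := exists_nat_gt (T / ε)
  have hn0 : (0 : ℝ) < n := (div_nonneg hT hε.le).trans_lt hn
  set d := T / n with hd
  have hd0 : 0 ≤ d := div_nonneg hT hn0.le
  have hdε : d < ε := by
    rw [hd, div_lt_iff₀ hn0]
    rw [div_lt_iff₀ hε] at hn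
    linarith
  have key : ∀ k : ℕ, FlowIsSymplecticAt Ω (hamiltonianVectorField Ω H) (k * d) (v s) := by
    intro k
    induction k with
    | zero => simpa using hεK (v s) ⟨s, rfl⟩ 0 ⟨le_rfl, hε⟩
    | succ k ih =>
      have h1 := ih.add (T' := d) hX (by positivity) hd0 (by
        rw [flow_integralCurve hX hv.integralCurve]
        exact hεK _ ⟨_, rfl⟩ d ⟨hd0, hdε⟩)
      convert h1 using 1
      push_cast; ring
  have := key n
  rwa [hd, mul_div_cancel₀ _ hn0.ne'] at this

end HamiltonianFlow

/-! ### Symplectic eigenbases and the matrices of the half-period maps -/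

section LinearAlgebra

/-- The vectors u + ru and w - rw are fixed and reversed by r. If b vanished on all such pairs,
subtracting the identities for (u, w) and (w, u) would give 4 b(u, w) = 0. A pair with nonzero
pairing is then normalized. -/
theorem exists_symplectic_eigenbasis {Q : Type*} [AddCommGroup Q] [Module ℝ Q]
    (hQ : Module.finrank ℝ Q = 2) {b : LinearMap.BilinForm ℝ Q} (hb : ∀ u w, b u w = - b w u)
    (hne : ∃ u w, b u w ≠ 0) {r : Module.End ℝ Q} (hr : ∀ u, r (r u) = u)
    (hanti : ∀ u w, b (r u) (r w) = - b u w) :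
    ∃ e : Module.Basis (Fin 2) ℝ Q, b (e 0) (e 1) = 1 ∧ r (e 0) = e 0 ∧ r (e 1) = - e 1 := by
  obtain ⟨p, q, hp, hq, hpq⟩ : ∃ p q, r p = p ∧ r q = - q ∧ b p q ≠ 0 := by
    by_contra! hcon
    obtain ⟨u, w, huw⟩ := hne
    have h1 := hcon (u + r u) (w - r w) (by simp [hr, add_comm]) (by simp [hr])
    have h2 := hcon (w + r w) (u - r u) (by simp [hr, add_comm]) (by simp [hr])
    have h3 := hanti u w
    simp only [map_add, map_sub, LinearMap.add_apply] at h1 h2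
    have h4 := hb w u
    have h5 := hb w (r u)
    have h6 := hb (r w) u
    have h7 := hb (r w) (r u)
    apply huw
    linarith
  have hbp : b p p = 0 := by linarith [hb p p]
  have hbq : b q q = 0 := by linarith [hb q q]
  have hqp : b q p ≠ 0 := by rw [hb]; exact neg_ne_zero.2 hpq
  set c := b p q with hc
  have hli : LinearIndependent ℝ ![c⁻¹ • p, q] := by
    rw [LinearIndependent.pair_iff]
    intro s t hst
    have h1 := congrArg (fun x => b x q) hst
    have h2 := congrArg (fun x => b x p) hst
    simp only [map_add, map_smul, LinearMap.add_apply, LinearMap.smul_apply, hbq, hbp, smul_eq_mul,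
      mul_zero, add_zero, zero_add, map_zero, LinearMap.zero_apply, ← hc] at h1 h2
    refine ⟨?_, ?_⟩
    · rwa [inv_mul_cancel₀ hpq, mul_one] at h1
    · exact (mul_eq_zero.1 h2).resolve_right hqp
  refine ⟨basisOfLinearIndependentOfCardEqFinrank hli (by simp [hQ]), ?_, ?_, ?_⟩
  · simp [← hc, hpq]
  · simp [hp]
  · simp [hq]

/-- The eigenlines of r are intrinsic, so the bases differ by scalings l and k with lk = 1, and the
entry is multiplied by k / l = k² > 0. -/
theorem toMatrix_eigenbasis_sign_eq {Q : Type*} [AddCommGroup Q] [Module ℝ Q]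
    {b : LinearMap.BilinForm ℝ Q} (hb : ∀ u w, b u w = - b w u) {r : Module.End ℝ Q}
    {e e' : Module.Basis (Fin 2) ℝ Q}
    (he : b (e 0) (e 1) = 1 ∧ r (e 0) = e 0 ∧ r (e 1) = - e 1)
    (he' : b (e' 0) (e' 1) = 1 ∧ r (e' 0) = e' 0 ∧ r (e' 1) = - e' 1) (m : Module.End ℝ Q) :
    SignType.sign (LinearMap.toMatrix e e m 0 1) = SignType.sign (LinearMap.toMatrix e' e' m 0 1) := by
  obtain ⟨h1, h2, h3⟩ := he
  obtain ⟨h1', h2', h3'⟩ := he'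
  have hexp : ∀ (e : Module.Basis (Fin 2) ℝ Q) u, u = e.repr u 0 • e 0 + e.repr u 1 • e 1 :=
    fun e u => by
      have := e.sum_repr u
      rw [Fin.sum_univ_two] at this
      exact this.symm
  obtain ⟨l, hl⟩ : ∃ l : ℝ, e' 0 = l • e 0 := by
    refine ⟨e.repr (e' 0) 0, ?_⟩
    have h5 := congrArg (fun x => e.repr x 1) h2'
    rw [hexp e (e' 0)] at h5
    simp [h2, h3] at h5
    have h6 : e.repr (e' 0) 1 = 0 := by linarith
    have h4 := hexp e (e' 0)
    rwa [h6, zero_smul, add_zero] at h4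
  obtain ⟨k, hk⟩ : ∃ k : ℝ, e' 1 = k • e 1 := by
    refine ⟨e.repr (e' 1) 1, ?_⟩
    have h5 := congrArg (fun x => e.repr x 0) h3'
    rw [hexp e (e' 1)] at h5
    simp [h2, h3] at h5
    have h6 : e.repr (e' 1) 0 = 0 := by linarith
    have h4 := hexp e (e' 1)
    rwa [h6, zero_smul, zero_add] at h4
  have hlk : l * k = 1 := by
    rw [hl, hk] at h1'
    simpa [h1, mul_comm] using h1'
  have hk0 : k ≠ 0 := right_ne_zero_of_mul_eq_one hlk
  have hentry : ∀ (e : Module.Basis (Fin 2) ℝ Q), b (e 0) (e 1) = 1 → ∀ u, e.repr u 0 = b u (e 1) := by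
    intro e h u
    have h11 : b (e 1) (e 1) = 0 := by linarith [hb (e 1) (e 1)]
    conv_rhs => rw [hexp e u]
    simp [h, h11]
  have : LinearMap.toMatrix e' e' m 0 1 = k ^ 2 * LinearMap.toMatrix e e m 0 1 := by
    rw [LinearMap.toMatrix_apply, LinearMap.toMatrix_apply, hentry e' h1', hentry e h1, hk]
    simp
    ring
  rw [this, sign_mul, sign_pos (by positivity : 0 < k ^ 2), one_mul]

/-- With f = (a, b; c, d) of determinant 1, the relation g r₁ f = r₀ determines g = (d, b; c, a);
the entries follow by multiplying out. -/
theorem monodromy_entries {Q₀ Q₁ : Type*} [AddCommGroup Q₀] [Module ℝ Q₀]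
    [AddCommGroup Q₁] [Module ℝ Q₁] {b₀ : LinearMap.BilinForm ℝ Q₀} {b₁ : LinearMap.BilinForm ℝ Q₁}
    (hb₁ : ∀ u w, b₁ u w = - b₁ w u)
    {r₀ : Module.End ℝ Q₀} {r₁ : Module.End ℝ Q₁}
    {e₀ : Module.Basis (Fin 2) ℝ Q₀} {e₁ : Module.Basis (Fin 2) ℝ Q₁}
    (he₀ : b₀ (e₀ 0) (e₀ 1) = 1 ∧ r₀ (e₀ 0) = e₀ 0 ∧ r₀ (e₀ 1) = - e₀ 1)
    (he₁ : b₁ (e₁ 0) (e₁ 1) = 1 ∧ r₁ (e₁ 0) = e₁ 0 ∧ r₁ (e₁ 1) = - e₁ 1)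
    {f : Q₀ →ₗ[ℝ] Q₁} {g : Q₁ →ₗ[ℝ] Q₀} (hf : ∀ u w, b₁ (f u) (f w) = b₀ u w)
    (hg : ∀ u, g (r₁ (f u)) = r₀ u) :
    ∃ a b c d : ℝ, a * d - b * c = 1 ∧ LinearMap.toMatrix e₀ e₀ (g ∘ₗ f) 0 1 = 2 * (b * d) ∧
      LinearMap.toMatrix e₁ e₁ (f ∘ₗ g) 0 1 = 2 * (a * b) ∧
      LinearMap.trace ℝ Q₀ (g ∘ₗ f) = 2 * (a * d + b * c) := by
  obtain ⟨h1, h2, h3⟩ := he₀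
  obtain ⟨h1', h2', h3'⟩ := he₁
  have hexp : ∀ u, u = e₁.repr u 0 • e₁ 0 + e₁.repr u 1 • e₁ 1 := fun u => by
    have := e₁.sum_repr u
    rw [Fin.sum_univ_two] at this
    exact this.symm
  obtain ⟨a, c, hac⟩ : ∃ a c : ℝ, f (e₀ 0) = a • e₁ 0 + c • e₁ 1 := ⟨_, _, hexp _⟩
  obtain ⟨b, d, hbd⟩ : ∃ b d : ℝ, f (e₀ 1) = b • e₁ 0 + d • e₁ 1 := ⟨_, _, hexp _⟩
  have hdet : a * d - b * c = 1 := by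
    have h := hf (e₀ 0) (e₀ 1)
    have h00 : b₁ (e₁ 0) (e₁ 0) = 0 := by linarith [hb₁ (e₁ 0) (e₁ 0)]
    have h11 : b₁ (e₁ 1) (e₁ 1) = 0 := by linarith [hb₁ (e₁ 1) (e₁ 1)]
    have h10 : b₁ (e₁ 1) (e₁ 0) = -1 := by rw [hb₁, h1']
    rw [h1, hac, hbd] at h
    simp [h00, h11, h10, h1'] at h
    linarith
  have g0 := hg (e₀ 0)
  have g1 := hg (e₀ 1)
  rw [hac, h2] at g0
  rw [hbd, h3] at g1
  simp only [map_add, map_smul, h2', h3', smul_neg, map_neg] at g0 g1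
  -- Cramer's rule for the system `g0`, `g1`, whose determinant is ±1 by `hdet`.
  have hg0 : g (e₁ 0) = d • e₀ 0 + c • e₀ 1 := by
    have : g (e₁ 0) = (a * d - b * c) • g (e₁ 0) := by rw [hdet, one_smul]
    rw [this, ← neg_neg (e₀ 1), ← g1]
    conv_rhs => rw [← g0]
    module
  have hg1 : g (e₁ 1) = b • e₀ 0 + a • e₀ 1 := by
    have : g (e₁ 1) = (a * d - b * c) • g (e₁ 1) := by rw [hdet, one_smul]
    rw [this, ← neg_neg (e₀ 1), ← g1]
    conv_rhs => rw [← g0]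
    module
  refine ⟨a, b, c, d, hdet, ?_, ?_, ?_⟩
  · rw [LinearMap.toMatrix_apply, LinearMap.comp_apply, hbd]
    simp [hg0, hg1]; ring
  · rw [LinearMap.toMatrix_apply, LinearMap.comp_apply, hg1]
    simp [hac, hbd]; ring
  · rw [LinearMap.trace_eq_matrix_trace ℝ e₀, Matrix.trace_fin_two, LinearMap.toMatrix_apply,
      LinearMap.toMatrix_apply, LinearMap.comp_apply, LinearMap.comp_apply, hac, hbd]
    simp [hg0, hg1]; ring

/-- The determinant condition gives t = 4ad - 2, so t < -2 is ad < 0; there bc = ad - 1 also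
excludes b = 0. -/
theorem sign_entries_dichotomy {a b c d t : ℝ} (hdet : a * d - b * c = 1)
    (ht : t = 2 * (a * d + b * c)) :
    (t ≠ 2 → t ≠ -2 → SignType.sign (2 * (b * d)) ≠ 0 ∧ SignType.sign (2 * (a * b)) ≠ 0) ∧
    (t ≠ -2 → (t < -2 ↔ SignType.sign (2 * (b * d)) ≠ SignType.sign (2 * (a * b)))) := by
  have hbc : b * c = a * d - 1 := by linarith
  have had : t ≠ -2 → a ≠ 0 ∧ d ≠ 0 := fun h => by
    refine mul_ne_zero_iff.1 fun h0 => h ?_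
    rw [ht, hbc, h0]; norm_num
  refine ⟨fun h2 h2' => ?_, fun h2' => ?_⟩
  · obtain ⟨ha, hd⟩ := had h2'
    have hb : b ≠ 0 := by
      rintro rfl
      apply h2
      rw [ht]
      linarith
    simp [sign_eq_zero_iff, ha, hb, hd]
  · obtain ⟨ha, hd⟩ := had h2'
    have hs : ∀ x y : ℝ, SignType.sign (2 * (x * y)) = SignType.sign x * SignType.sign y := by
      intro x y
      rw [sign_mul, sign_mul, sign_pos two_pos, one_mul]
    rw [hs, hs, ht, hbc]
    have hlt : 2 * (a * d + (a * d - 1)) < -2 ↔ a * d < 0 := by constructor <;> intro h <;> linarith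
    rw [hlt]
    constructor
    · intro h
      have hb : b ≠ 0 := by
        rintro rfl
        linarith
      rcases mul_neg_iff.1 h with ⟨ha, hd⟩ | ⟨ha, hd⟩ <;> rcases lt_or_gt_of_ne hb with hb | hb <;>
        simp [ha, hd, hb]
    · intro h
      by_contra hcon
      have hpos : 0 < a * d := lt_of_le_of_ne (not_lt.1 hcon) (mul_ne_zero ha hd).symm
      apply h
      rcases mul_pos_iff.1 hpos with ⟨ha, hd⟩ | ⟨ha, hd⟩
      · simp [ha, hd]
      · simp [ha, hd]

variable {V V' : Type*} [AddCommGroup V] [Module ℝ V] [AddCommGroup V'] [Module ℝ V']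

/-- The map of subquotients induced by a linear map. -/
def inducedMap (K L : Submodule ℝ V) (K' L' : Submodule ℝ V') (F : V →ₗ[ℝ] V')
    (hK : ∀ u ∈ K, F u ∈ K') (hL : ∀ u ∈ L, F u ∈ L') :
    (K ⧸ L.submoduleOf K) →ₗ[ℝ] (K' ⧸ L'.submoduleOf K') :=
  (L.submoduleOf K).mapQ (L'.submoduleOf K') (F.restrict hK) (fun u hu => hL u hu)

theorem inducedEnd_mk {K L : Submodule ℝ V} {A : Module.End ℝ V} (h : Preserves K L A) (u : K) :
    inducedEnd K L A (Submodule.Quotient.mk u) = Submodule.Quotient.mk ⟨A u, h.1 u u.2⟩ := by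
  rw [inducedEnd, dif_pos h]
  rfl

theorem finrank_subquotient [FiniteDimensional ℝ V] (hV : Module.finrank ℝ V = 4)
    {h : V →ₗ[ℝ] ℝ} (hh : h ≠ 0) {X : V} (hX : X ≠ 0) (hhX : h X = 0) :
    Module.finrank ℝ (LinearMap.ker h ⧸ (Submodule.span ℝ {X}).submoduleOf (LinearMap.ker h))
      = 2 := by
  have h1 := LinearMap.finrank_range_add_finrank_ker h
  have h2 : Module.finrank ℝ (LinearMap.range h) = 1 := by
    rw [LinearMap.range_eq_top.2 (LinearMap.surjective hh), finrank_top, Module.finrank_self]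
  have hle : Submodule.span ℝ {X} ≤ LinearMap.ker h := by
    rw [Submodule.span_singleton_le_iff_mem]; exact hhX
  have h3 := (Submodule.submoduleOfEquivOfLe hle).finrank_eq
  rw [finrank_span_singleton hX] at h3
  have h4 := ((Submodule.span ℝ {X}).submoduleOf (LinearMap.ker h)).finrank_quotient_add_finrank
  omega

/-- If σ vanished on ker h, then for u in ker h the functional σ(u, ·) would be a multiple of h,
that is, of σ(·, X). Nondegeneracy would put u in the span of X, but ker h has dimension 3. -/
theorem exists_form_ne_zero [FiniteDimensional ℝ V] (hV : Module.finrank ℝ V = 4)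
    {σ : LinearMap.BilinForm ℝ V} (hσ : ∀ u w, σ u w = - σ w u)
    (hnd : ∀ u, (∀ w, σ u w = 0) → u = 0)
    {h : V →ₗ[ℝ] ℝ} (hh : h ≠ 0) {X : V} (hX : X ≠ 0) (hhX : ∀ u, h u = σ u X) :
    ∃ u w, h u = 0 ∧ h w = 0 ∧ σ u w ≠ 0 := by
  by_contra! hcon
  obtain ⟨n, hn⟩ : ∃ n, h n ≠ 0 := by
    by_contra! h0
    exact hh (LinearMap.ext h0)
  have hle : LinearMap.ker h ≤ Submodule.span ℝ {X} := by
    intro u hu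
    rw [Submodule.mem_span_singleton]
    refine ⟨- (σ u n / h n), ?_⟩
    have h0 : u + (σ u n / h n) • X = 0 := by
      refine hnd _ fun w => ?_
      have h1 := hcon u (w - (h w / h n) • n) hu (by simp [hn])
      rw [map_sub, map_smul, smul_eq_mul, sub_eq_zero] at h1
      rw [map_add, LinearMap.add_apply, map_smul, LinearMap.smul_apply, hσ X w, ← hhX, h1,
        smul_eq_mul]
      ring
    rw [neg_smul]
    exact (eq_neg_of_add_eq_zero_left h0).symm
  have h1 := LinearMap.finrank_range_add_finrank_ker h
  have h2 : Module.finrank ℝ (LinearMap.range h) = 1 := by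
    rw [LinearMap.range_eq_top.2 (LinearMap.surjective hh), finrank_top, Module.finrank_self]
  have h3 := Submodule.finrank_mono hle
  rw [finrank_span_singleton hX] at h3
  omega

end LinearAlgebra

/-! ### Differentials with a prescribed target point -/

section Differential

variable {E : Type*} [NormedAddCommGroup E] [NormedSpace ℝ E]
  {M : Type*} [TopologicalSpace M] [ChartedSpace E M]

/-- The differential at `x` of a map `f` with `f x = y`, as a linear map from `T_x M` to `T_y M`. -/
def differentialTo (f : M → M) (x y : M) : TangentSpace 𝓘(ℝ, E) x →ₗ[ℝ] TangentSpace 𝓘(ℝ, E) y :=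
  (mfderiv 𝓘(ℝ, E) 𝓘(ℝ, E) f x :
    TangentSpace 𝓘(ℝ, E) x →L[ℝ] TangentSpace 𝓘(ℝ, E) y).toLinearMap

theorem differentialTo_comp {f g : M → M} {x y : M} (hf : MDifferentiableAt 𝓘(ℝ, E) 𝓘(ℝ, E) f x)
    (hy : f x = y) (hg : MDifferentiableAt 𝓘(ℝ, E) 𝓘(ℝ, E) g y) (z : M)
    (u : TangentSpace 𝓘(ℝ, E) x) :
    differentialTo (g ∘ f) x z u = differentialTo g y z (differentialTo f x y u) := by
  subst hy
  exact DFunLike.congr_fun (mfderiv_comp x hg hf) u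

theorem differentialTo_congr {f g : M → M} {x : M} (h : f =ᶠ[𝓝 x] g) (y : M)
    (u : TangentSpace 𝓘(ℝ, E) x) : differentialTo f x y u = differentialTo g x y u :=
  DFunLike.congr_fun h.mfderiv_eq u

theorem differentialTo_id (x : M) (u : TangentSpace 𝓘(ℝ, E) x) :
    differentialTo (id : M → M) x x u = u :=
  DFunLike.congr_fun (mfderiv_id (I := 𝓘(ℝ, E)) (x := x)) u

theorem differential_differentialTo {H : M → ℝ} {f : M → M} {x y : M}
    (hf : MDifferentiableAt 𝓘(ℝ, E) 𝓘(ℝ, E) f x) (hy : f x = y)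
    (hH : MDifferentiableAt 𝓘(ℝ, E) 𝓘(ℝ, ℝ) H y) (u : TangentSpace 𝓘(ℝ, E) x) :
    differential H y (differentialTo f x y u) = differential (E := E) (H ∘ f) x u := by
  subst hy
  exact (DFunLike.congr_fun (mfderiv_comp x hH hf) u).symm

end Differential

/-! ### The involution reverses the Hamiltonian flow -/

section Involution

variable {E : Type*} [NormedAddCommGroup E] [NormedSpace ℝ E]
  {M : Type*} [TopologicalSpace M] [ChartedSpace E M]
  {Ω : SymplecticForm E M} {ρ : M → M}

theorem IsAntisymplecticInvolution.mdifferentiableAt (hρ : IsAntisymplecticInvolution Ω ρ) (x : M) :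
    MDifferentiableAt 𝓘(ℝ, E) 𝓘(ℝ, E) ρ x :=
  hρ.smooth.mdifferentiableAt (by norm_num)

theorem IsAntisymplecticInvolution.form_differentialTo (hρ : IsAntisymplecticInvolution Ω ρ)
    {x y : M} (hy : ρ x = y) (u w : TangentSpace 𝓘(ℝ, E) x) :
    Ω.toFun y (differentialTo ρ x y u) (differentialTo ρ x y w) = - Ω.toFun x u w := by
  subst hy
  exact hρ.antisymplectic x u w

theorem IsAntisymplecticInvolution.differentialTo_differentialTo
    (hρ : IsAntisymplecticInvolution Ω ρ) {x y : M} (hy : ρ x = y) (u : TangentSpace 𝓘(ℝ, E) x) :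
    differentialTo ρ y x (differentialTo ρ x y u) = u := by
  rw [← differentialTo_comp (hρ.mdifferentiableAt x) hy (hρ.mdifferentiableAt y),
    hρ.involutive.comp_self, differentialTo_id]

theorem IsAntisymplecticInvolution.differential_differentialTo
    (hρ : IsAntisymplecticInvolution Ω ρ) {H : M → ℝ} (hH : ContMDiff 𝓘(ℝ, E) 𝓘(ℝ, ℝ) ∞ H)
    (hHρ : ∀ x, H (ρ x) = H x) {x y : M} (hy : ρ x = y) (u : TangentSpace 𝓘(ℝ, E) x) :
    differential H y (differentialTo ρ x y u) = differential H x u := by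
  rw [SymOrbit.differential_differentialTo (hρ.mdifferentiableAt x) hy
    (hH.mdifferentiableAt (by norm_num)), show H ∘ ρ = H from funext hHρ]

variable [FiniteDimensional ℝ E]

/-- Ω(u, dρ X_H) = -Ω(dρ u, X_H) = -dH(dρ u) = -dH(u) = -Ω(u, X_H) for every u, and Ω is
nondegenerate. -/
theorem IsAntisymplecticInvolution.differentialTo_hamiltonianVectorField
    (hρ : IsAntisymplecticInvolution Ω ρ) {H : M → ℝ} (hH : ContMDiff 𝓘(ℝ, E) 𝓘(ℝ, ℝ) ∞ H)
    (hHρ : ∀ x, H (ρ x) = H x) {x y : M} (hy : ρ x = y) :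
    differentialTo ρ x y (hamiltonianVectorField Ω H x) = - hamiltonianVectorField Ω H y := by
  have hx : ρ y = x := by rw [← hy, hρ.involutive]
  rw [eq_neg_iff_add_eq_zero]
  refine Ω.nondegenerate _ _ fun u => ?_
  rw [Ω.neg_swap, map_add, ← hamiltonianVectorField_spec]
  have h1 := hρ.form_differentialTo hy (differentialTo ρ y x u) (hamiltonianVectorField Ω H x)
  rw [hρ.differentialTo_differentialTo hx, ← hamiltonianVectorField_spec,
    hρ.differential_differentialTo hH hHρ hx] at h1
  rw [h1]
  ring

/-- An antisymplectic involution preserving `H` reverses the Hamiltonian flow. -/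
theorem IsAntisymplecticInvolution.isSolutionUpTo_reverse
    (hρ : IsAntisymplecticInvolution Ω ρ) {H : M → ℝ} (hH : ContMDiff 𝓘(ℝ, E) 𝓘(ℝ, ℝ) ∞ H)
    (hHρ : ∀ x, H (ρ x) = H x) {x : M} {T : ℝ} {γ : ℝ → M}
    (h : IsSolutionUpTo (hamiltonianVectorField Ω H) x T γ) :
    IsSolutionUpTo (hamiltonianVectorField Ω H) (ρ (γ T)) T (fun t => ρ (γ (T - t))) := by
  obtain ⟨h0, a, b, h0m, htm, hc⟩ := h
  refine ⟨by simp, T - b, T - a, ⟨by linarith [htm.2], by linarith [htm.1]⟩,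
    ⟨by linarith [h0m.2], by linarith [h0m.1]⟩, fun t ht => ?_⟩
  have htt : T - t ∈ Ioo a b := ⟨by linarith [ht.2], by linarith [ht.1]⟩
  have h1 : HasMFDerivAt 𝓘(ℝ, ℝ) 𝓘(ℝ, E) γ (T - t) _ :=
    (hc (T - t) htt).hasMFDerivAt (isOpen_Ioo.mem_nhds htt)
  have h2 : HasDerivAt (fun t => T - t) (-1) t := by
    simpa using (hasDerivAt_id t).const_sub T
  have h3 := (hρ.mdifferentiableAt (γ (T - t))).hasMFDerivAt.comp t
    (h1.comp t h2.hasFDerivAt.hasMFDerivAt)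
  refine (h3.congr_mfderiv ?_).hasMFDerivWithinAt
  refine ContinuousLinearMap.ext_ring ?_
  -- The sign from dρ X_H = -X_H cancels the one from reversing time.
  have h4 := hρ.differentialTo_hamiltonianVectorField hH hHρ (x := γ (T - t)) rfl
  change (differentialTo ρ (γ (T - t)) (ρ (γ (T - t)))
    (((1 : ℝ) • (-1 : ℝ)) • hamiltonianVectorField Ω H (γ (T - t))) : E)
    = (1 : ℝ) • (hamiltonianVectorField Ω H (ρ (γ (T - t))) : E)
  rw [map_smul, h4]
  simp

end Involution

/-! ### The linearized flow along the periodic orbit -/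

section Orbit

variable {E : Type*} [NormedAddCommGroup E] [NormedSpace ℝ E] [FiniteDimensional ℝ E]
  {M : Type*} [TopologicalSpace M] [ChartedSpace E M] [IsManifold 𝓘(ℝ, E) ∞ M] [T2Space M]
  {Ω : SymplecticForm E M} {H : M → ℝ} {ρ : M → M} {τ : ℝ} {v : ℝ → M}

theorem IsPeriodicOrbit.flow_apply (hH : ContMDiff 𝓘(ℝ, E) 𝓘(ℝ, ℝ) ∞ H)
    (hv : IsPeriodicOrbit Ω H τ v) (s T : ℝ) :
    flow (hamiltonianVectorField Ω H) T (v s) = v (s + T) := by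
  have : IsManifold 𝓘(ℝ, E) 1 M := .of_le (n := ∞) (by norm_cast)
  exact flow_integralCurve (contMDiff_hamiltonianVectorField Ω hH) hv.integralCurve s T

/-- At a zero of X_H the constant curve is an integral curve, and uniqueness would make v constant.
-/
theorem IsPeriodicOrbit.hamiltonianVectorField_ne_zero (hH : ContMDiff 𝓘(ℝ, E) 𝓘(ℝ, ℝ) ∞ H)
    (hv : IsPeriodicOrbit Ω H τ v) (s : ℝ) : hamiltonianVectorField Ω H (v s) ≠ 0 := by
  intro h0
  have : IsManifold 𝓘(ℝ, E) 1 M := .of_le (n := ∞) (by norm_cast)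
  have h1 := isMIntegralCurve_Ioo_eq_of_contMDiff_boundaryless (t₀ := s)
    (contMDiff_hamiltonianVectorField Ω hH) hv.integralCurve (isMIntegralCurve_const h0) rfl
  obtain ⟨a, b, hab⟩ := hv.nonconstant
  exact hab (by rw [h1])

theorem IsPeriodicOrbit.form_differentialTo_flow (hH : ContMDiff 𝓘(ℝ, E) 𝓘(ℝ, ℝ) ∞ H)
    (hv : IsPeriodicOrbit Ω H τ v) {s T : ℝ} (hT : 0 ≤ T) {y : M} (hy : v (s + T) = y)
    (u w : TangentSpace 𝓘(ℝ, E) (v s)) :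
    Ω.toFun y (differentialTo (flow (hamiltonianVectorField Ω H) T) (v s) y u)
      (differentialTo (flow (hamiltonianVectorField Ω H) T) (v s) y w) = Ω.toFun (v s) u w := by
  rw [← hv.flow_apply hH] at hy
  subst hy
  exact (hv.flowIsSymplecticAt hH s hT).form_eq u w

/-- Differentiate φ^T(v(s)) = v(s + T) in s. -/
theorem IsPeriodicOrbit.differentialTo_flow_hamiltonianVectorField
    (hH : ContMDiff 𝓘(ℝ, E) 𝓘(ℝ, ℝ) ∞ H)
    (hv : IsPeriodicOrbit Ω H τ v) {s T : ℝ} (hT : 0 ≤ T) {y : M} (hy : v (s + T) = y) :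
    differentialTo (flow (hamiltonianVectorField Ω H) T) (v s) y (hamiltonianVectorField Ω H (v s))
      = hamiltonianVectorField Ω H y := by
  subst hy
  have h1 := (hv.flowIsSymplecticAt hH s hT).mdifferentiableAt.hasMFDerivAt.comp s
    (hv.integralCurve s)
  have h2 : flow (hamiltonianVectorField Ω H) T ∘ v = v ∘ (· + T) :=
    funext fun s => hv.flow_apply hH s T
  rw [h2] at h1
  have h3 := hasMFDerivAt_unique h1 (hv.integralCurve.comp_add T s)
  have h4 := DFunLike.congr_fun h3 (1 : ℝ)
  change (differentialTo (flow (hamiltonianVectorField Ω H) T) (v s) (v (s + T))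
    ((1 : ℝ) • hamiltonianVectorField Ω H (v s)) : E)
    = (1 : ℝ) • (hamiltonianVectorField Ω H (v (s + T)) : E) at h4
  rwa [one_smul, one_smul] at h4

/-- ker dH is the Ω-orthogonal of X_H, and the linearized flow preserves both Ω and X_H. -/
theorem IsPeriodicOrbit.differentialTo_flow_mem_energyTangent
    (hH : ContMDiff 𝓘(ℝ, E) 𝓘(ℝ, ℝ) ∞ H)
    (hv : IsPeriodicOrbit Ω H τ v) {s T : ℝ} (hT : 0 ≤ T) {y : M} (hy : v (s + T) = y)
    {u : TangentSpace 𝓘(ℝ, E) (v s)} (hu : u ∈ energyTangent H (v s)) :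
    differentialTo (flow (hamiltonianVectorField Ω H) T) (v s) y u ∈ energyTangent H y := by
  change differential H y _ = 0
  rw [hamiltonianVectorField_spec Ω, ← hv.differentialTo_flow_hamiltonianVectorField hH hT hy,
    hv.form_differentialTo_flow hH hT hy, ← hamiltonianVectorField_spec]
  exact hu

theorem IsPeriodicOrbit.differentialTo_flow_mem_hamiltonianLine
    (hH : ContMDiff 𝓘(ℝ, E) 𝓘(ℝ, ℝ) ∞ H)
    (hv : IsPeriodicOrbit Ω H τ v) {s T : ℝ} (hT : 0 ≤ T) {y : M} (hy : v (s + T) = y)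
    {u : TangentSpace 𝓘(ℝ, E) (v s)} (hu : u ∈ hamiltonianLine Ω H (v s)) :
    differentialTo (flow (hamiltonianVectorField Ω H) T) (v s) y u ∈ hamiltonianLine Ω H y := by
  obtain ⟨c, rfl⟩ := Submodule.mem_span_singleton.1 hu
  rw [map_smul, hv.differentialTo_flow_hamiltonianVectorField hH hT hy]
  exact Submodule.smul_mem _ _ (Submodule.mem_span_singleton_self _)

theorem IsPeriodicOrbit.hasReducedMonodromy (hH : ContMDiff 𝓘(ℝ, E) 𝓘(ℝ, ℝ) ∞ H)
    (hv : IsPeriodicOrbit Ω H τ v) (s : ℝ) : HasReducedMonodromy Ω H τ (v s) :=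
  ⟨by rw [hv.flow_apply hH, hv.periodic],
    (hv.flowIsSymplecticAt hH s hv.period_pos.le).mdifferentiableAt,
    fun _ hu => hv.differentialTo_flow_mem_energyTangent hH hv.period_pos.le (hv.periodic s) hu,
    fun _ hu => hv.differentialTo_flow_mem_hamiltonianLine hH hv.period_pos.le (hv.periodic s) hu⟩

theorem IsPeriodicOrbit.monodromy_eq (hH : ContMDiff 𝓘(ℝ, E) 𝓘(ℝ, ℝ) ∞ H)
    (hv : IsPeriodicOrbit Ω H τ v) {s : ℝ} {y : M} (hy : v (s + τ / 2) = y)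
    (u : TangentSpace 𝓘(ℝ, E) (v s)) :
    monodromy Ω H τ (v s) u =
      differentialTo (flow (hamiltonianVectorField Ω H) (τ / 2)) y (v s)
        (differentialTo (flow (hamiltonianVectorField Ω H) (τ / 2)) (v s) y u) := by
  have : IsManifold 𝓘(ℝ, E) 1 M := .of_le (n := ∞) (by norm_cast)
  have hτ : 0 ≤ τ / 2 := by linarith [hv.period_pos]
  have h1 := hv.flowIsSymplecticAt hH s hτ
  have h2 : FlowIsSymplecticAt Ω (hamiltonianVectorField Ω H) (τ / 2)
      (flow (hamiltonianVectorField Ω H) (τ / 2) (v s)) := by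
    rw [hv.flow_apply hH]; exact hv.flowIsSymplecticAt hH _ hτ
  have hfy : flow (hamiltonianVectorField Ω H) (τ / 2) (v s) = y := by rw [hv.flow_apply hH, hy]
  have h3 := h1.flow_add_eventuallyEq (contMDiff_hamiltonianVectorField Ω hH) hτ hτ h2
  rw [add_halves] at h3
  rw [hfy] at h2
  rw [← differentialTo_comp h1.mdifferentiableAt hfy h2.mdifferentiableAt]
  exact differentialTo_congr (h3.mono fun y hy => hy.2) (v s) u

/-- Flowing for time T, reflecting and flowing for time T again retraces the reflected trajectory,
so φ^T ∘ ρ ∘ φ^T = ρ near v(s); the chain rule gives the claim. -/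
theorem IsPeriodicOrbit.differentialTo_flow_reverse (hρ : IsAntisymplecticInvolution Ω ρ)
    (hH : ContMDiff 𝓘(ℝ, E) 𝓘(ℝ, ℝ) ∞ H) (hHρ : ∀ x, H (ρ x) = H x)
    (hv : IsPeriodicOrbit Ω H τ v) {s T : ℝ} (hT : 0 ≤ T)
    (hsT : ρ (v (s + T)) = v (s + T)) (u : TangentSpace 𝓘(ℝ, E) (v s)) :
    differentialTo (flow (hamiltonianVectorField Ω H) T) (v (s + T)) (v s)
      (differentialTo ρ (v (s + T)) (v (s + T))
        (differentialTo (flow (hamiltonianVectorField Ω H) T) (v s) (v (s + T)) u))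
      = differentialTo ρ (v s) (v s) u := by
  have : IsManifold 𝓘(ℝ, E) 1 M := .of_le (n := ∞) (by norm_cast)
  have hX := contMDiff_hamiltonianVectorField Ω hH
  have h1 := hv.flowIsSymplecticAt hH s hT
  have h2 := hv.flowIsSymplecticAt hH (s + T) hT
  have h3 : flow (hamiltonianVectorField Ω H) T ∘ (ρ ∘ flow (hamiltonianVectorField Ω H) T)
      =ᶠ[𝓝 (v s)] ρ := by
    filter_upwards [h1.exists_solution] with y ⟨γ, hγ⟩
    have h4 := hρ.isSolutionUpTo_reverse hH hHρ hγ
    rw [Function.comp_apply, Function.comp_apply, flow_eq hX hγ, flow_eq hX h4, sub_self, hγ.1]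
  rw [← differentialTo_congr h3,
    differentialTo_comp ((hρ.mdifferentiableAt _).comp _ h1.mdifferentiableAt)
      (y := v (s + T)) (by rw [Function.comp_apply, hv.flow_apply hH, hsT]) h2.mdifferentiableAt,
    differentialTo_comp h1.mdifferentiableAt (hv.flow_apply hH s T) (hρ.mdifferentiableAt _)]

end Orbit

/-! ### The reduced spaces, the B-signs and their comparison -/

section Reduced

variable {E : Type*} [NormedAddCommGroup E] [NormedSpace ℝ E] [FiniteDimensional ℝ E]
  {M : Type*} [TopologicalSpace M] [ChartedSpace E M]
  {Ω : SymplecticForm E M} {H : M → ℝ} {ρ : M → M}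

theorem reducedForm_neg_swap (x : M) (u w : ReducedSpace Ω H x) :
    reducedForm Ω H x u w = - reducedForm Ω H x w u := by
  obtain ⟨u, rfl⟩ := Submodule.Quotient.mk_surjective _ u
  obtain ⟨w, rfl⟩ := Submodule.Quotient.mk_surjective _ w
  exact Ω.neg_swap x _ _

theorem IsAntisymplecticInvolution.preserves (hρ : IsAntisymplecticInvolution Ω ρ)
    (hH : ContMDiff 𝓘(ℝ, E) 𝓘(ℝ, ℝ) ∞ H) (hHρ : ∀ x, H (ρ x) = H x) {x : M} (hx : ρ x = x) :
    Preserves (energyTangent H x) (hamiltonianLine Ω H x)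
      (differentialAtFixedPoint (E := E) ρ x) := by
  refine ⟨fun u hu => ?_, fun u hu => ?_⟩
  · exact (hρ.differential_differentialTo hH hHρ hx u).trans hu
  · obtain ⟨c, rfl⟩ := Submodule.mem_span_singleton.1 hu
    change differentialTo ρ x x (c • hamiltonianVectorField Ω H x) ∈ hamiltonianLine Ω H x
    rw [map_smul, hρ.differentialTo_hamiltonianVectorField hH hHρ hx]
    exact Submodule.smul_mem _ _ (Submodule.neg_mem _ (Submodule.mem_span_singleton_self _))

theorem exists_isSymplecticEigenbasis (hE : Module.finrank ℝ E = 4)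
    (hρ : IsAntisymplecticInvolution Ω ρ)
    (hH : ContMDiff 𝓘(ℝ, E) 𝓘(ℝ, ℝ) ∞ H) (hHρ : ∀ x, H (ρ x) = H x) {x : M} (hx : ρ x = x)
    (hX : hamiltonianVectorField Ω H x ≠ 0) :
    ∃ e : Module.Basis (Fin 2) ℝ (ReducedSpace Ω H x), IsSymplecticEigenbasis Ω H ρ x e := by
  have : FiniteDimensional ℝ (TangentSpace 𝓘(ℝ, E) x) := inferInstanceAs (FiniteDimensional ℝ E)
  have hV : Module.finrank ℝ (TangentSpace 𝓘(ℝ, E) x) = 4 := hE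
  have hspec := hamiltonianVectorField_spec Ω H x
  have hdH : differential (E := E) H x ≠ 0 := by
    intro h0
    refine hX (Ω.nondegenerate x _ fun u => ?_)
    rw [Ω.neg_swap, ← hspec, h0]
    simp
  have hdX : differential H x (hamiltonianVectorField Ω H x) = 0 := by
    rw [hspec, Ω.alternating]
  have hpres := hρ.preserves hH hHρ hx
  have hQ : Module.finrank ℝ (ReducedSpace Ω H x) = 2 := finrank_subquotient hV hdH hX hdX
  refine exists_symplectic_eigenbasis hQ (b := reducedForm Ω H x)
    (r := reducedInvolution Ω H ρ x) (reducedForm_neg_swap x) ?_ ?_ ?_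
  · obtain ⟨u, w, hu, hw, huw⟩ := exists_form_ne_zero hV (Ω.neg_swap x) (Ω.nondegenerate x) hdH hX
      hspec
    exact ⟨Submodule.Quotient.mk ⟨u, hu⟩, Submodule.Quotient.mk ⟨w, hw⟩, huw⟩
  · intro u
    obtain ⟨u, rfl⟩ := Submodule.Quotient.mk_surjective _ u
    rw [reducedInvolution, inducedEnd_mk hpres, inducedEnd_mk hpres]
    congr 1
    exact Subtype.ext (hρ.differentialTo_differentialTo hx u)
  · intro u w
    obtain ⟨u, rfl⟩ := Submodule.Quotient.mk_surjective _ u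
    obtain ⟨w, rfl⟩ := Submodule.Quotient.mk_surjective _ w
    rw [reducedInvolution, inducedEnd_mk hpres, inducedEnd_mk hpres]
    exact hρ.form_differentialTo hx u w

theorem isBSign_unique {τ : ℝ} {x : M} {s s' : SignType} (h : IsBSign Ω H ρ τ x s)
    (h' : IsBSign Ω H ρ τ x s') : s = s' := by
  obtain ⟨e, he, rfl⟩ := h
  obtain ⟨e', he', rfl⟩ := h'
  exact toMatrix_eigenbasis_sign_eq (reducedForm_neg_swap x) he he' _

variable [IsManifold 𝓘(ℝ, E) ∞ M] [T2Space M] {τ : ℝ} {v : ℝ → M}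

theorem IsPeriodicOrbit.existsUnique_isBSign (hE : Module.finrank ℝ E = 4)
    (hρ : IsAntisymplecticInvolution Ω ρ)
    (hH : ContMDiff 𝓘(ℝ, E) 𝓘(ℝ, ℝ) ∞ H) (hHρ : ∀ x, H (ρ x) = H x)
    (hv : IsPeriodicOrbit Ω H τ v) {s : ℝ} (hs : ρ (v s) = v s) :
    ∃! b : SignType, IsBSign Ω H ρ τ (v s) b := by
  obtain ⟨e, he⟩ := exists_isSymplecticEigenbasis hE hρ hH hHρ hs
    (hv.hamiltonianVectorField_ne_zero hH s)
  exact ⟨_, ⟨e, he, rfl⟩, fun b hb => isBSign_unique hb ⟨e, he, rfl⟩⟩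

theorem IsPeriodicOrbit.bSigns (hρ : IsAntisymplecticInvolution Ω ρ)
    (hH : ContMDiff 𝓘(ℝ, E) 𝓘(ℝ, ℝ) ∞ H) (hHρ : ∀ x, H (ρ x) = H x)
    (hv : IsPeriodicOrbit Ω H τ v) {x₀ x₁ : M} (h₀ : v 0 = x₀) (h₁ : v (τ / 2) = x₁)
    (hx₀ : ρ x₀ = x₀) (hx₁ : ρ x₁ = x₁) {s₀ s₁ : SignType}
    (hs₀ : IsBSign Ω H ρ τ x₀ s₀) (hs₁ : IsBSign Ω H ρ τ x₁ s₁) :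
    (reducedTrace Ω H τ x₀ ≠ 2 → reducedTrace Ω H τ x₀ ≠ -2 → s₀ ≠ 0 ∧ s₁ ≠ 0) ∧
      (reducedTrace Ω H τ x₀ ≠ -2 → (reducedTrace Ω H τ x₀ < -2 ↔ s₀ ≠ s₁)) := by
  subst h₀ h₁
  obtain ⟨e₀, he₀, rfl⟩ := hs₀
  obtain ⟨e₁, he₁, rfl⟩ := hs₁
  have hτ : 0 ≤ τ / 2 := by linarith [hv.period_pos]
  have h01 : v (0 + τ / 2) = v (τ / 2) := by rw [zero_add]
  have h10 : v (τ / 2 + τ / 2) = v 0 := by rw [add_halves, ← hv.periodic 0, zero_add]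
  set X := hamiltonianVectorField Ω H with hXdef
  -- The two half-period maps, whose composites in the two orders are the two reduced monodromies.
  let f : ReducedSpace Ω H (v 0) →ₗ[ℝ] ReducedSpace Ω H (v (τ / 2)) :=
    inducedMap _ _ _ _ (differentialTo (flow X (τ / 2)) (v 0) (v (τ / 2)))
      (fun u hu => hv.differentialTo_flow_mem_energyTangent hH hτ h01 hu)
      (fun u hu => hv.differentialTo_flow_mem_hamiltonianLine hH hτ h01 hu)
  let g : ReducedSpace Ω H (v (τ / 2)) →ₗ[ℝ] ReducedSpace Ω H (v 0) :=
    inducedMap _ _ _ _ (differentialTo (flow X (τ / 2)) (v (τ / 2)) (v 0))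
      (fun u hu => hv.differentialTo_flow_mem_energyTangent hH hτ h10 hu)
      (fun u hu => hv.differentialTo_flow_mem_hamiltonianLine hH hτ h10 hu)
  have hm₀ : reducedMonodromy Ω H τ (v 0) = g ∘ₗ f := by
    ext u
    refine (inducedEnd_mk (hv.hasReducedMonodromy hH 0).2.2 u).trans ?_
    exact congrArg Submodule.Quotient.mk (Subtype.ext (hv.monodromy_eq hH h01 u))
  have hm₁ : reducedMonodromy Ω H τ (v (τ / 2)) = f ∘ₗ g := by
    ext u
    refine (inducedEnd_mk (hv.hasReducedMonodromy hH (τ / 2)).2.2 u).trans ?_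
    exact congrArg Submodule.Quotient.mk (Subtype.ext (hv.monodromy_eq hH h10 u))
  have hf : ∀ u w, reducedForm Ω H (v (τ / 2)) (f u) (f w) = reducedForm Ω H (v 0) u w := by
    intro u w
    obtain ⟨u, rfl⟩ := Submodule.Quotient.mk_surjective _ u
    obtain ⟨w, rfl⟩ := Submodule.Quotient.mk_surjective _ w
    exact hv.form_differentialTo_flow hH hτ h01 u w
  have hg : ∀ u, g (reducedInvolution Ω H ρ (v (τ / 2)) (f u))
      = reducedInvolution Ω H ρ (v 0) u := by
    intro u
    obtain ⟨u, rfl⟩ := Submodule.Quotient.mk_surjective _ u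
    have hrev := hv.differentialTo_flow_reverse hρ hH hHρ (s := 0) hτ (by rwa [h01])
      (u : TangentSpace 𝓘(ℝ, E) (v 0))
    rw [h01] at hrev
    have hr₁ := inducedEnd_mk (hρ.preserves hH hHρ hx₁)
      ⟨differentialTo (flow X (τ / 2)) (v 0) (v (τ / 2)) u,
        hv.differentialTo_flow_mem_energyTangent hH hτ h01 u.2⟩
    refine (congrArg g hr₁).trans (Eq.trans ?_ (inducedEnd_mk (hρ.preserves hH hHρ hx₀) u).symm)
    exact congrArg Submodule.Quotient.mk (Subtype.ext hrev)
  obtain ⟨a, b, c, d, hdet, h1, h2, h3⟩ :=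
    monodromy_entries (reducedForm_neg_swap _) he₀ he₁ hf hg
  rw [reducedTrace, hm₀, hm₁, h1, h2]
  exact sign_entries_dichotomy hdet h3

end Reduced

end SymOrbit

end

theorem theoremC
    {M : Type*} [TopologicalSpace M] [T2Space M] [ChartedSpace (EuclideanSpace ℝ (Fin 4)) M]
    [IsManifold (𝓡 4) ∞ M]
    (Ω : SymOrbit.SymplecticForm (EuclideanSpace ℝ (Fin 4)) M)
    (ρ : M → M) (hρ : SymOrbit.IsAntisymplecticInvolution Ω ρ)
    (H : M → ℝ) (hH : ContMDiff (𝓡 4) 𝓘(ℝ, ℝ) ∞ H) (hHρ : ∀ x, H (ρ x) = H x)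
    (τ : ℝ) (v : ℝ → M) (hv : SymOrbit.IsSymmetricPeriodicOrbit Ω H ρ τ v) :
    (SymOrbit.HasReducedMonodromy Ω H τ (v 0) ∧
      SymOrbit.HasReducedMonodromy Ω H τ (v (τ / 2))) ∧
    (∃! s₀ : SignType, SymOrbit.IsBSign Ω H ρ τ (v 0) s₀) ∧
    (∃! s₁ : SignType, SymOrbit.IsBSign Ω H ρ τ (v (τ / 2)) s₁) ∧
    ∀ s₀ s₁ : SignType,
      SymOrbit.IsBSign Ω H ρ τ (v 0) s₀ → SymOrbit.IsBSign Ω H ρ τ (v (τ / 2)) s₁ →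
      (SymOrbit.reducedTrace Ω H τ (v 0) ≠ 2 → SymOrbit.reducedTrace Ω H τ (v 0) ≠ -2 →
        s₀ ≠ 0 ∧ s₁ ≠ 0) ∧
      (SymOrbit.reducedTrace Ω H τ (v 0) ≠ -2 →
        (SymOrbit.IsNegativeHyperbolic Ω H τ v ↔ s₀ ≠ s₁)) := by
  have hfix₀ : ρ (v 0) = v 0 := by simpa using hv.symmetric 0
  have hfix₁ : ρ (v (τ / 2)) = v (τ / 2) := by
    have h1 := hv.symmetric (τ / 2)
    -- Periodicity identifies v(-τ/2) with v(τ/2), so the symmetry at time τ/2 says that this point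
    -- is fixed by ρ.
    have h2 := hv.periodic (-(τ / 2))
    rw [show -(τ / 2) + τ = τ / 2 by ring] at h2
    rwa [← h2] at h1
  have hE : Module.finrank ℝ (EuclideanSpace ℝ (Fin 4)) = 4 := by simp
  have hv' := hv.toIsPeriodicOrbit
  exact ⟨⟨hv'.hasReducedMonodromy hH 0, hv'.hasReducedMonodromy hH (τ / 2)⟩,
    hv'.existsUnique_isBSign hE hρ hH hHρ hfix₀, hv'.existsUnique_isBSign hE hρ hH hHρ hfix₁,
    fun s₀ s₁ h₀ h₁ =>
      SymOrbit.IsPeriodicOrbit.bSigns hρ hH hHρ hv' rfl rfl hfix₀ hfix₁ h₀ h₁⟩
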